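/- Let $\mathbb F$ be a field of characteristic different from $2$ and $3$ over which every polynomial of degree $2$ or $3$ has a root. An algebra over $\mathbb F$ is a vector space with a bilinear product (no associativity, commutativity or unit is assumed); it is nontrivial if its product is not identically zero. For a $2\times 4$ matrix $A=\begin{pmatrix}\alpha_1&\alpha_2&\alpha_3&\alpha_4\\ \beta_1&\beta_2&\beta_3&\beta_4\end{pmatrix}$ also denote by $A$ the algebra with basis $e_1,e_2$ and product $e_1e_1=\alpha_1e_1+\beta_1e_2$, $e_1e_2=\alpha_2e_1+\beta_2e_2$, $e_2e_1=\alpha_3e_1+\beta_3e_2$, $e_2e_2=\alpha_4e_1+\beta_4e_2$, and put $p_A(y)=\alpha_4y^3+(\alpha_2+\alpha_3-\beta_4)y^2+(\alpha_1-\beta_2-\beta_3)y-\beta_1$. For parameters in $\mathbb F$ let $$A_1(\alpha_1,\alpha_2,\alpha_4,\beta_1)=\begin{pmatrix}\alpha_1&\alpha_2&\alpha_2+1&\alpha_4\\ \beta_1&-\alpha_1&-\alpha_1+1&-\alpha_2\end{pmatrix},\quad A_2(\alpha_1,\beta_1,\beta_2)=\begin{pmatrix}\alpha_1&0&0&1\\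 \beta_1&\beta_2&1-\alpha_1&0\end{pmatrix},$$ $$A_3(\beta_1,\beta_2)=\begin{pmatrix}0&1&1&0\\ \beta_1&\beta_2&1&-1\end{pmatrix},\quad A_4(\alpha_1,\beta_2)=\begin{pmatrix}\alpha_1&0&0&0\\ 0&\beta_2&1-\alpha_1&0\end{pmatrix},\quad A_5(\alpha_1)=\begin{pmatrix}\alpha_1&0&0&0\\ 1&2\alpha_1-1&1-\alpha_1&0\end{pmatrix},$$ $$A_6(\alpha_1,\beta_1)=\begin{pmatrix}\alpha_1&0&0&1\\ \beta_1&1-\alpha_1&-\alpha_1&0\end{pmatrix},\quad A_7(\beta_1)=\begin{pmatrix}0&1&1&0\\ \beta_1&1&0&-1\end{pmatrix},\quad A_8(\alpha_1)=\begin{pmatrix}\alpha_1&0&0&0\\ 0&1-\alpha_1&-\alpha_1&0\end{pmatrix},$$ $$A_9=\begin{pmatrix}\tfrac13&0&0&0\\ 1&\tfrac23&-\tfrac13&0\end{pmatrix},\quad A_{10}=\begin{pmatrix}0&1&1&0\\ 0&0&0&-1\end{pmatrix},\quad A_{11}=\begin{pmatrix}0&1&1&0\\ 1&0&0&-1\end{pmatrix},\quad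 A_{12}=\begin{pmatrix}0&0&0&0\\ 1&0&0&0\end{pmatrix}.$$ Call these algebras, for all parameter values, the canonical algebras; $A_2(\alpha_1,\beta_1,\beta_2)$ and $A_2(\alpha_1,-\beta_1,\beta_2)$ are identified, and so are $A_6(\alpha_1,\beta_1)$ and $A_6(\alpha_1,-\beta_1)$. With $\sqrt{x}$ a chosen square root of $x$ (the conditions below do not depend on the choice), put $$y_{\mp1}=\frac{-(3\alpha_2+1)\mp\sqrt{(3\alpha_2+1)^2-3\alpha_4(3\alpha_1-1)}}{3\alpha_4}\ (\alpha_4\ne0),\quad y_{\mp2}=\mp\frac{\sqrt{3(1+\beta_2-2\alpha_1)}}{3},\quad y_{\mp6}=\pm\frac{\sqrt{3(1-3\alpha_1)}}{3}.$$ **Theorem.** Every nontrivial two-dimensional algebra over $\mathbb F$ has exactly one, two, three or infinitely many one-dimensional subalgebras. All canonical algebras are nontrivial and two-dimensional. A nontrivial two-dimensional algebra has exactly one (respectively exactly two, exactly three, infinitely many) one-dimensional subalgebras if and only if it is isomorphic to exactly one canonical algebra, up to the identifications above (identified algebras being isomorphic), and that one is in the corresponding list below; and a canonical algebra has that number of one-dimensional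 subalgebras if and only if its parameters satisfy the condition in the corresponding list. *One:* - $A_1(\alpha_1,\alpha_2,\alpha_4,\beta_1)$ with $\alpha_4\ne0$, $\alpha_1=\frac{(3\alpha_2+1)^2}{9\alpha_4}+\frac13$, $\beta_1=\frac{-(3\alpha_2+1)^3}{27\alpha_4^2}$; - $A_1(\frac13,-\frac13,0,\beta_1)$ with $\beta_1\ne0$; - $A_2(\alpha_1,0,2\alpha_1-1)$; $A_5(\alpha_1)$; $A_6(\frac13,0)$; $A_9$; $A_{12}$. *Two:* - $A_1(\alpha_1,\alpha_2,\alpha_4,\beta_1)$ with $\alpha_4\ne0$, $\alpha_1\ne\frac{(3\alpha_2+1)^2}{9\alpha_4}+\frac13$, $p_{A_1}(y_{-1})p_{A_1}(y_{+1})=0$; - $A_1(\alpha_1,\alpha_2,0,\beta_1)$ with $\alpha_2\ne-\frac13$, $(3\alpha_1-1)^2+4(3\alpha_2+1)\beta_1=0$; - $A_1(\alpha_1,-\frac13,0,\beta_1)$ with $\alpha_1\ne\frac13$; - $A_2(\alpha_1,\beta_1,\beta_2)$ with $\beta_2\ne2\alpha_1-1$, $p_{A_2}(y_{-2})p_{A_2}(y_{+2})=0$;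 - $A_3(-\frac{(\beta_2+1)^2}{12},\beta_2)$; $A_4(\alpha_1,\beta_2)$ with $\beta_2\ne2\alpha_1-1$; - $A_6(\alpha_1,\beta_1)$ with $\alpha_1\ne\frac13$, $p_{A_6}(y_{-6})p_{A_6}(y_{+6})=0$; - $A_7(-\frac1{12})$; $A_8(\alpha_1)$ with $\alpha_1\ne\frac13$; $A_{10}$. *Three:* - $A_1(\alpha_1,\alpha_2,\alpha_4,\beta_1)$ with $\alpha_4\ne0$, $p_{A_1}(y_{-1})p_{A_1}(y_{+1})\ne0$; - $A_1(\alpha_1,\alpha_2,0,\beta_1)$ with $(3\alpha_2+1)\big((3\alpha_1-1)^2+4(3\alpha_2+1)\beta_1\big)\ne0$; - $A_2(\alpha_1,\beta_1,\beta_2)$ with $p_{A_2}(y_{-2})p_{A_2}(y_{+2})\ne0$; $A_3(\beta_1,\beta_2)$ with $(\beta_2+1)^2+12\beta_1\ne0$; - $A_6(\alpha_1,\beta_1)$ with $p_{A_6}(y_{-6})p_{A_6}(y_{+6})\ne0$; $A_7(\beta_1)$ with $12\beta_1+1\ne0$; $A_{11}$. *Infinitely many:* $A_1(\frac13,-\frac13,0,0)$;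 $A_4(\alpha_1,2\alpha_1-1)$; $A_8(\frac13)$. -/

import Mathlib

open Module

universe u v w

namespace TwoDim

/-! ### Algebras, isomorphisms, one-dimensional subalgebras

An algebra over a field `F` (not assumed associative, commutative or unital) is a type `A` with
`[NonUnitalNonAssocRing A] [Module F A] [IsScalarTower F A A] [SMulCommClass F A A]`. -/

/-- Two algebras over `F` are isomorphic: there is a bijective `F`-linear multiplicative map. -/
def Iso (F : Type u) [Field F] (A : Type v) (B : Type w)
    [NonUnitalNonAssocRing A] [Module F A] [NonUnitalNonAssocRing B] [Module F B] : Prop :=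
  ∃ f : A →ₙₐ[F] B, Function.Bijective f

/-- An algebra is nontrivial when its multiplication is not identically zero. -/
def NontrivialMul (A : Type v) [NonUnitalNonAssocRing A] : Prop :=
  ∃ x y : A, x * y ≠ 0

/-- The number (in `ℕ∞`) of one-dimensional subalgebras; `⊤` means infinitely many. -/
noncomputable def numSubalgebras (F : Type u) [Field F] (A : Type v)
    [NonUnitalNonAssocRing A] [Module F A] : ℕ∞ :=
  Set.encard {S : NonUnitalSubalgebra F A | finrank F S = 1}

/-! ### The algebra given by a matrix of structure constants -/

/-- The matrix of structure constants
`(α₁ α₂ α₃ α₄ ; β₁ β₂ β₃ β₄)`, whose columns are the coordinates of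
`e₁e₁, e₁e₂, e₂e₁, e₂e₂`. -/
abbrev MSC (F : Type u) := Matrix (Fin 2) (Fin 4) F

/-- The vector space `F²`, with the bilinear product prescribed by `M` on the standard basis. -/
def MSCAlgebra {F : Type u} (_M : MSC F) : Type u := Fin 2 → F

namespace MSCAlgebra

variable {F : Type u} [Field F] (M : MSC F)

instance : AddCommGroup (MSCAlgebra M) := inferInstanceAs (AddCommGroup (Fin 2 → F))

instance : Module F (MSCAlgebra M) := inferInstanceAs (Module F (Fin 2 → F))

instance : Mul (MSCAlgebra M) where
  mul u v := fun i =>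
    M i 0 * (u 0 * v 0) + M i 1 * (u 0 * v 1) + M i 2 * (u 1 * v 0) + M i 3 * (u 1 * v 1)

variable {M}

theorem mul_apply (u v : MSCAlgebra M) (i : Fin 2) :
    (u * v) i =
      M i 0 * (u 0 * v 0) + M i 1 * (u 0 * v 1) + M i 2 * (u 1 * v 0) + M i 3 * (u 1 * v 1) :=
  rfl

theorem add_apply (u v : MSCAlgebra M) (i : Fin 2) : (u + v) i = u i + v i := rfl

theorem smul_apply (c : F) (u : MSCAlgebra M) (i : Fin 2) : (c • u) i = c * u i := rfl

theorem zero_apply (i : Fin 2) : (0 : MSCAlgebra M) i = 0 := rfl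

variable (M)

instance : NonUnitalNonAssocRing (MSCAlgebra M) where
  left_distrib a b c := by
    funext i; simp only [mul_apply, add_apply]; ring
  right_distrib a b c := by
    funext i; simp only [mul_apply, add_apply]; ring
  zero_mul a := by
    funext i; simp only [mul_apply, zero_apply]; ring
  mul_zero a := by
    funext i; simp only [mul_apply, zero_apply]; ring

instance : IsScalarTower F (MSCAlgebra M) (MSCAlgebra M) where
  smul_assoc c a b := by
    funext i; simp only [smul_eq_mul, mul_apply, smul_apply]; ring

instance : SMulCommClass F (MSCAlgebra M) (MSCAlgebra M) where
  smul_comm c a b := by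
    funext i; simp only [smul_eq_mul, mul_apply, smul_apply]; ring

end MSCAlgebra

/-- The polynomial function `p_A(y) = α₄y³ + (α₂+α₃-β₄)y² + (α₁-β₂-β₃)y - β₁`. -/
def MSC.p {F : Type u} [Field F] (M : MSC F) (y : F) : F :=
  M 0 3 * y ^ 3 + (M 0 1 + M 0 2 - M 1 3) * y ^ 2 + (M 0 0 - M 1 1 - M 1 2) * y - M 1 0

/-! ### The canonical families `A₁, …, A₁₂` -/

/-- The canonical families together with their parameters. -/
inductive CanonicalForm (F : Type u) : Type u
  | A1 (α₁ α₂ α₄ β₁ : F)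
  | A2 (α₁ β₁ β₂ : F)
  | A3 (β₁ β₂ : F)
  | A4 (α₁ β₂ : F)
  | A5 (α₁ : F)
  | A6 (α₁ β₁ : F)
  | A7 (β₁ : F)
  | A8 (α₁ : F)
  | A9
  | A10
  | A11
  | A12

/-- A chosen square root of `x` (meaningful when `x` is a square). -/
noncomputable def sqrtOf {F : Type u} [Field F] (x : F) : F :=
  Classical.epsilon fun s : F => s ^ 2 = x

theorem sqrtOf_sq {F : Type u} [Field F] {x : F} (h : ∃ s : F, s ^ 2 = x) :
    sqrtOf x ^ 2 = x :=
  Classical.epsilon_spec h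

namespace CanonicalForm

variable {F : Type u} [Field F]

/-- The matrix of structure constants of a canonical form. -/
def msc : CanonicalForm F → MSC F
  | A1 α₁ α₂ α₄ β₁ => !![α₁, α₂, α₂ + 1, α₄; β₁, -α₁, -α₁ + 1, -α₂]
  | A2 α₁ β₁ β₂ => !![α₁, 0, 0, 1; β₁, β₂, 1 - α₁, 0]
  | A3 β₁ β₂ => !![0, 1, 1, 0; β₁, β₂, 1, -1]
  | A4 α₁ β₂ => !![α₁, 0, 0, 0; 0, β₂, 1 - α₁, 0]
  | A5 α₁ => !![α₁, 0, 0, 0; 1, 2 * α₁ - 1, 1 - α₁, 0]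
  | A6 α₁ β₁ => !![α₁, 0, 0, 1; β₁, 1 - α₁, -α₁, 0]
  | A7 β₁ => !![0, 1, 1, 0; β₁, 1, 0, -1]
  | A8 α₁ => !![α₁, 0, 0, 0; 0, 1 - α₁, -α₁, 0]
  | A9 => !![1 / 3, 0, 0, 0; 1, 2 / 3, -(1 / 3), 0]
  | A10 => !![0, 1, 1, 0; 0, 0, 0, -1]
  | A11 => !![0, 1, 1, 0; 1, 0, 0, -1]
  | A12 => !![0, 0, 0, 0; 1, 0, 0, 0]

/-- The algebra `F²` with the structure constants of the canonical form `c`. -/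
abbrev Alg (c : CanonicalForm F) : Type u := MSCAlgebra c.msc

/-- The change of parameters `β₁ ↦ -β₁` in the families `A₂` and `A₆`. -/
def flip : CanonicalForm F → CanonicalForm F
  | A2 α₁ β₁ β₂ => A2 α₁ (-β₁) β₂
  | A6 α₁ β₁ => A6 α₁ (-β₁)
  | c => c

/-- The identification of parameters `A₂(α₁, β₁, β₂) ≃ A₂(α₁, -β₁, β₂)` and
`A₆(α₁, β₁) ≃ A₆(α₁, -β₁)`: two canonical forms count as the same one when they are equal or
differ by the sign of `β₁` in one of these two families. -/
def Same (c c' : CanonicalForm F) : Prop := c' = c ∨ c' = c.flip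

/-- `p_{A₁}(y₋₁) p_{A₁}(y₊₁)`, where `y₋₁, y₊₁` are the critical points of `p_{A₁}`. -/
noncomputable def crit1 (α₁ α₂ α₄ β₁ : F) : F :=
  (A1 α₁ α₂ α₄ β₁).msc.p
      ((-(3 * α₂ + 1) - sqrtOf ((3 * α₂ + 1) ^ 2 - 3 * α₄ * (3 * α₁ - 1))) / (3 * α₄)) *
    (A1 α₁ α₂ α₄ β₁).msc.p
      ((-(3 * α₂ + 1) + sqrtOf ((3 * α₂ + 1) ^ 2 - 3 * α₄ * (3 * α₁ - 1))) / (3 * α₄))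

/-- `p_{A₂}(y₋₂) p_{A₂}(y₊₂)`, where `y₋₂, y₊₂` are the critical points of `p_{A₂}`. -/
noncomputable def crit2 (α₁ β₁ β₂ : F) : F :=
  (A2 α₁ β₁ β₂).msc.p (-sqrtOf (3 * (1 + β₂ - 2 * α₁)) / 3) *
    (A2 α₁ β₁ β₂).msc.p (sqrtOf (3 * (1 + β₂ - 2 * α₁)) / 3)

/-- `p_{A₆}(y₋₆) p_{A₆}(y₊₆)`, where `y₋₆, y₊₆` are the critical points of `p_{A₆}`. -/
noncomputable def crit6 (α₁ β₁ : F) : F :=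
  (A6 α₁ β₁).msc.p (sqrtOf (3 * (1 - 3 * α₁)) / 3) *
    (A6 α₁ β₁).msc.p (-sqrtOf (3 * (1 - 3 * α₁)) / 3)

/-- The parameter conditions for exactly one subalgebra. -/
def OneList : CanonicalForm F → Prop
  | A1 α₁ α₂ α₄ β₁ =>
      (α₄ ≠ 0 ∧ α₁ = (3 * α₂ + 1) ^ 2 / (9 * α₄) + 1 / 3 ∧
        β₁ = -(3 * α₂ + 1) ^ 3 / (27 * α₄ ^ 2)) ∨
      (α₁ = 1 / 3 ∧ α₂ = -(1 / 3) ∧ α₄ = 0 ∧ β₁ ≠ 0)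
  | A2 α₁ β₁ β₂ => β₁ = 0 ∧ β₂ = 2 * α₁ - 1
  | A3 _ _ => False
  | A4 _ _ => False
  | A5 _ => True
  | A6 α₁ β₁ => α₁ = 1 / 3 ∧ β₁ = 0
  | A7 _ => False
  | A8 _ => False
  | A9 => True
  | A10 => False
  | A11 => False
  | A12 => True

/-- The parameter conditions for exactly two subalgebras. -/
def TwoList : CanonicalForm F → Prop
  | A1 α₁ α₂ α₄ β₁ =>
      (α₄ ≠ 0 ∧ α₁ ≠ (3 * α₂ + 1) ^ 2 / (9 * α₄) + 1 / 3 ∧ crit1 α₁ α₂ α₄ β₁ = 0) ∨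
      (α₄ = 0 ∧ α₂ ≠ -(1 / 3) ∧ (3 * α₁ - 1) ^ 2 + 4 * (3 * α₂ + 1) * β₁ = 0) ∨
      (α₄ = 0 ∧ α₁ ≠ 1 / 3 ∧ α₂ = -(1 / 3))
  | A2 α₁ β₁ β₂ => β₂ ≠ 2 * α₁ - 1 ∧ crit2 α₁ β₁ β₂ = 0
  | A3 β₁ β₂ => β₁ = -((β₂ + 1) ^ 2 / 12)
  | A4 α₁ β₂ => β₂ ≠ 2 * α₁ - 1
  | A5 _ => False
  | A6 α₁ β₁ => α₁ ≠ 1 / 3 ∧ crit6 α₁ β₁ = 0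
  | A7 β₁ => β₁ = -(1 / 12)
  | A8 α₁ => α₁ ≠ 1 / 3
  | A9 => False
  | A10 => True
  | A11 => False
  | A12 => False

/-- The parameter conditions for exactly three subalgebras. -/
def ThreeList : CanonicalForm F → Prop
  | A1 α₁ α₂ α₄ β₁ =>
      (α₄ ≠ 0 ∧ crit1 α₁ α₂ α₄ β₁ ≠ 0) ∨
      (α₄ = 0 ∧ (3 * α₂ + 1) * ((3 * α₁ - 1) ^ 2 + 4 * (3 * α₂ + 1) * β₁) ≠ 0)
  | A2 α₁ β₁ β₂ => crit2 α₁ β₁ β₂ ≠ 0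
  | A3 β₁ β₂ => (β₂ + 1) ^ 2 + 12 * β₁ ≠ 0
  | A4 _ _ => False
  | A5 _ => False
  | A6 α₁ β₁ => crit6 α₁ β₁ ≠ 0
  | A7 β₁ => 12 * β₁ + 1 ≠ 0
  | A8 _ => False
  | A9 => False
  | A10 => False
  | A11 => True
  | A12 => False

/-- The parameter conditions for infinitely many subalgebras. -/
def InfiniteList : CanonicalForm F → Prop
  | A1 α₁ α₂ α₄ β₁ => α₁ = 1 / 3 ∧ α₂ = -(1 / 3) ∧ α₄ = 0 ∧ β₁ = 0
  | A2 _ _ _ => False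
  | A3 _ _ => False
  | A4 α₁ β₂ => β₂ = 2 * α₁ - 1
  | A5 _ => False
  | A6 _ _ => False
  | A7 _ => False
  | A8 α₁ => α₁ = 1 / 3
  | A9 => False
  | A10 => False
  | A11 => False
  | A12 => False

end CanonicalForm

/-- `A` is isomorphic to exactly one canonical form, up to the identification `Same`, and that form
satisfies the condition `L`. -/
def IsomorphicOnlyToOneOf {F : Type u} [Field F] (L : CanonicalForm F → Prop)
    (A : Type v) [NonUnitalNonAssocRing A] [Module F A] : Prop :=
  ∃ c : CanonicalForm F, L c ∧ ∀ c' : CanonicalForm F, Iso F A c'.Alg ↔ c.Same c'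

end TwoDim

namespace TwoDim

/-! ### Isomorphisms, changes of basis and the two trace functionals -/

section Iso

variable {F : Type u} [Field F]

/-! Counting. A line spanned by `v` is a subalgebra exactly when `v * v` is proportional to `v`. In
coordinates this says that a binary cubic form vanishes at `v`. Up to sign, its value at `(1, y)` is
`p y`, and its value at `(0, 1)` is `α₄`. The subalgebras are thus the zeros of this form on the
projective line (`numSubalgebras_MSCAlgebra`). Over `F` the form splits, so there are one, two or
three distinct zeros, or the form is zero and every line is a subalgebra; `F` is infinite. For a
cubic `p` the number of distinct roots is read off the discriminant, which is, up to a nonzero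
factor, the product of the two critical values (`critical_values_mul`); a triple root is the case in
which the critical points coincide and are a root.

Classification. The traces of left and right multiplication are two linear functionals, carried to
one another by isomorphisms. If they are independent, their dual basis is canonical, and the
remaining structure constants, those of `A1`, are complete invariants. If they are dependent and not
both zero, take `e₂` in the common kernel and normalise a nonzero trace to be 1 on `e₁`. The only
freedom left is `e₁ ↦ e₁ + t e₂`, `e₂ ↦ d e₂`, and the vanishing of `α₄`, then `α₂`, then `β₁`
separates the families. If both traces are zero, any basis is allowed, and a root of `p` provides
one with `α₄ = 0`; three algebras remain, told apart by their numbers of subalgebras.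

The results are `hasCanonicalForm` and `iso_iff_same`. The number of subalgebras is an isomorphism
invariant, so the theorem reduces to the canonical algebras. -/

theorem Iso.refl (A : Type v) [NonUnitalNonAssocRing A] [Module F A] : Iso F A A :=
  ⟨NonUnitalAlgHom.id F A, Function.bijective_id⟩

theorem Iso.symm {A : Type v} {B : Type w} [NonUnitalNonAssocRing A] [Module F A]
    [NonUnitalNonAssocRing B] [Module F B] (h : Iso F A B) : Iso F B A := by
  obtain ⟨f, hf⟩ := h
  let e := Equiv.ofBijective f hf
  have hl : Function.LeftInverse e.symm f := e.left_inv
  have hr : Function.RightInverse e.symm f := e.right_inv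
  exact ⟨f.inverse e.symm hl hr, e.symm.bijective⟩

theorem Iso.trans {A B C : Type*} [NonUnitalNonAssocRing A] [Module F A]
    [NonUnitalNonAssocRing B] [Module F B] [NonUnitalNonAssocRing C] [Module F C]
    (h : Iso F A B) (h' : Iso F B C) : Iso F A C := by
  obtain ⟨f, hf⟩ := h
  obtain ⟨g, hg⟩ := h'
  exact ⟨g.comp f, hg.comp hf⟩

theorem Iso.nontrivialMul {A : Type v} {B : Type w} [NonUnitalNonAssocRing A] [Module F A]
    [NonUnitalNonAssocRing B] [Module F B] (h : Iso F A B) (hA : NontrivialMul A) :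
    NontrivialMul B := by
  obtain ⟨f, hf⟩ := h
  obtain ⟨x, y, hxy⟩ := hA
  refine ⟨f x, f y, fun h0 => hxy (hf.1 ?_)⟩
  rw [map_mul, h0, map_zero]

theorem Iso.numSubalgebras_le {A : Type v} {B : Type w} [NonUnitalNonAssocRing A] [Module F A]
    [IsScalarTower F A A] [SMulCommClass F A A]
    [NonUnitalNonAssocRing B] [Module F B] [IsScalarTower F B B] [SMulCommClass F B B]
    (h : Iso F A B) : numSubalgebras F A ≤ numSubalgebras F B := by
  obtain ⟨f, hf⟩ := h
  unfold numSubalgebras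
  refine Set.encard_le_encard_of_injOn (f := fun S => S.map f) ?_ ?_
  · intro S hS
    have e : (S.map f).toSubmodule = S.toSubmodule.map (f : A →ₗ[F] B) := by
      ext x; simp
    change finrank F (S.map f).toSubmodule = 1
    rw [e]
    exact (LinearEquiv.finrank_eq (Submodule.equivMapOfInjective (f : A →ₗ[F] B) hf.1
      S.toSubmodule)).symm.trans hS
  · intro S _ T _ hST
    exact NonUnitalSubalgebra.map_injective (f := f) hf.1 hST

theorem Iso.numSubalgebras_eq {A : Type v} {B : Type w} [NonUnitalNonAssocRing A] [Module F A]
    [IsScalarTower F A A] [SMulCommClass F A A]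
    [NonUnitalNonAssocRing B] [Module F B] [IsScalarTower F B B] [SMulCommClass F B B]
    (h : Iso F A B) : numSubalgebras F A = numSubalgebras F B :=
  le_antisymm h.numSubalgebras_le h.symm.numSubalgebras_le

/-- The vector `x e₁ + y e₂` of `MSCAlgebra M`. -/
def MSCAlgebra.mk {F : Type u} {M : MSC F} (x y : F) : MSCAlgebra M := (![x, y] : Fin 2 → F)

@[simp]
theorem MSCAlgebra.mk_zero {F : Type u} {M : MSC F} (x y : F) : (MSCAlgebra.mk x y : MSCAlgebra M) 0 = x := rfl

@[simp]
theorem MSCAlgebra.mk_one {F : Type u} {M : MSC F} (x y : F) : (MSCAlgebra.mk x y : MSCAlgebra M) 1 = y := rfl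

theorem finrank_MSCAlgebra (M : MSC F) : finrank F (MSCAlgebra M) = 2 :=
  (finrank_fin_fun F (n := 2))

/-- The matrix of structure constants of an algebra in a basis. -/
theorem exists_iso_MSCAlgebra (A : Type v) [NonUnitalNonAssocRing A] [Module F A]
    [IsScalarTower F A A] [SMulCommClass F A A] (h : finrank F A = 2) :
    ∃ M : MSC F, Iso F A (MSCAlgebra M) := by
  have : Module.Finite F A := Module.finite_of_finrank_eq_succ h
  let b : Basis (Fin 2) F A := finBasisOfFinrankEq F A h
  let M : MSC F := !![b.repr (b 0 * b 0) 0, b.repr (b 0 * b 1) 0, b.repr (b 1 * b 0) 0,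
      b.repr (b 1 * b 1) 0;
    b.repr (b 0 * b 0) 1, b.repr (b 0 * b 1) 1, b.repr (b 1 * b 0) 1, b.repr (b 1 * b 1) 1]
  let e : A ≃ₗ[F] (Fin 2 → F) := b.equivFun
  refine ⟨M, ⟨{
    toFun := fun x => (e x : Fin 2 → F)
    map_smul' := fun c x => e.map_smul c x
    map_zero' := e.map_zero
    map_add' := e.map_add
    map_mul' := ?_ }, e.bijective⟩⟩
  intro x y
  have hx : x = e x 0 • b 0 + e x 1 • b 1 :=
    (b.sum_equivFun x).symm.trans (Fin.sum_univ_two _)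
  have hy : y = e y 0 • b 0 + e y 1 • b 1 :=
    (b.sum_equivFun y).symm.trans (Fin.sum_univ_two _)
  funext i
  have hxy : ∀ j, e (x * y) j = b.repr (b 0 * b 0) j * (e x 0 * e y 0)
      + b.repr (b 0 * b 1) j * (e x 0 * e y 1) + b.repr (b 1 * b 0) j * (e x 1 * e y 0)
      + b.repr (b 1 * b 1) j * (e x 1 * e y 1) := by
    intro j
    have h := congrArg₂ (· * ·) hx hy
    rw [h]
    simp only [add_mul, mul_add, smul_mul_assoc, mul_smul_comm, map_add, map_smul,
      Pi.add_apply, Pi.smul_apply, smul_eq_mul]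
    simp only [e, Basis.equivFun_apply]
    ring
  fin_cases i
  · exact hxy 0
  · exact hxy 1

/-- `u = (a, c)` and `v = (b, d)` form a basis of `F²` in which the product of `MSCAlgebra M` has
structure constants `N`. -/
structure IsChange (N M : MSC F) (a b c d : F) : Prop where
  det : a * d - b * c ≠ 0
  uu0 : M 0 0 * (a * a) + M 0 1 * (a * c) + M 0 2 * (c * a) + M 0 3 * (c * c)
    = N 0 0 * a + N 1 0 * b
  uu1 : M 1 0 * (a * a) + M 1 1 * (a * c) + M 1 2 * (c * a) + M 1 3 * (c * c)
    = N 0 0 * c + N 1 0 * d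
  uv0 : M 0 0 * (a * b) + M 0 1 * (a * d) + M 0 2 * (c * b) + M 0 3 * (c * d)
    = N 0 1 * a + N 1 1 * b
  uv1 : M 1 0 * (a * b) + M 1 1 * (a * d) + M 1 2 * (c * b) + M 1 3 * (c * d)
    = N 0 1 * c + N 1 1 * d
  vu0 : M 0 0 * (b * a) + M 0 1 * (b * c) + M 0 2 * (d * a) + M 0 3 * (d * c)
    = N 0 2 * a + N 1 2 * b
  vu1 : M 1 0 * (b * a) + M 1 1 * (b * c) + M 1 2 * (d * a) + M 1 3 * (d * c)
    = N 0 2 * c + N 1 2 * d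
  vv0 : M 0 0 * (b * b) + M 0 1 * (b * d) + M 0 2 * (d * b) + M 0 3 * (d * d)
    = N 0 3 * a + N 1 3 * b
  vv1 : M 1 0 * (b * b) + M 1 1 * (b * d) + M 1 2 * (d * b) + M 1 3 * (d * d)
    = N 0 3 * c + N 1 3 * d

theorem IsChange.iso {N M : MSC F} {a b c d : F} (h : IsChange N M a b c d) :
    Iso F (MSCAlgebra N) (MSCAlgebra M) := by
  have hdet := h.det
  refine ⟨{
    toFun := fun x => MSCAlgebra.mk (x 0 * a + x 1 * b) (x 0 * c + x 1 * d)
    map_smul' := ?_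
    map_zero' := ?_
    map_add' := ?_
    map_mul' := ?_ }, ?_, ?_⟩
  · intro k x
    funext i
    fin_cases i <;> simp [MSCAlgebra.smul_apply] <;> ring
  · funext i
    fin_cases i <;> simp [MSCAlgebra.zero_apply]
  · intro x y
    funext i
    fin_cases i <;> simp [MSCAlgebra.add_apply] <;> ring
  · intro x y
    funext i
    fin_cases i
    · simp [MSCAlgebra.mul_apply]
      linear_combination -x 0 * y 0 * h.uu0 - x 0 * y 1 * h.uv0 - x 1 * y 0 * h.vu0
        - x 1 * y 1 * h.vv0
    · simp [MSCAlgebra.mul_apply]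
      linear_combination -x 0 * y 0 * h.uu1 - x 0 * y 1 * h.uv1 - x 1 * y 0 * h.vu1
        - x 1 * y 1 * h.vv1
  · intro x y hxy
    have h0 : x 0 * a + x 1 * b = y 0 * a + y 1 * b := congrFun hxy 0
    have h1 : x 0 * c + x 1 * d = y 0 * c + y 1 * d := congrFun hxy 1
    funext i
    apply mul_left_cancel₀ hdet
    fin_cases i
    · simp only [Fin.zero_eta]
      linear_combination d * h0 - b * h1
    · simp only [Fin.mk_one]
      linear_combination a * h1 - c * h0
  · intro y
    refine ⟨MSCAlgebra.mk ((d * y 0 - b * y 1) / (a * d - b * c))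
      ((a * y 1 - c * y 0) / (a * d - b * c)), ?_⟩
    funext i
    fin_cases i
    · change (d * y 0 - b * y 1) / (a * d - b * c) * a
        + (a * y 1 - c * y 0) / (a * d - b * c) * b = y 0
      rw [div_mul_eq_mul_div, div_mul_eq_mul_div, ← add_div, div_eq_iff hdet]
      ring
    · change (d * y 0 - b * y 1) / (a * d - b * c) * c
        + (a * y 1 - c * y 0) / (a * d - b * c) * d = y 1
      rw [div_mul_eq_mul_div, div_mul_eq_mul_div, ← add_div, div_eq_iff hdet]
      ring

theorem Iso.exists_isChange {N M : MSC F} (h : Iso F (MSCAlgebra N) (MSCAlgebra M)) :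
    ∃ a b c d, IsChange N M a b c d := by
  obtain ⟨f, hf⟩ := h
  obtain ⟨e, he⟩ : ∃ e : Fin 2 → MSCAlgebra N, e = ![MSCAlgebra.mk 1 0, MSCAlgebra.mk 0 1] :=
    ⟨_, rfl⟩
  have h00 : e 0 0 = 1 := by rw [he]; rfl
  have h01 : e 0 1 = 0 := by rw [he]; rfl
  have h10 : e 1 0 = 0 := by rw [he]; rfl
  have h11 : e 1 1 = 1 := by rw [he]; rfl
  have hval : ∀ x : MSCAlgebra N, f x = x 0 • f (e 0) + x 1 • f (e 1) := by
    intro x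
    rw [← map_smul, ← map_smul, ← map_add]
    congr 1
    funext i
    fin_cases i <;> simp [h00, h01, h10, h11, MSCAlgebra.add_apply, MSCAlgebra.smul_apply]
  have hv : ∀ (x : MSCAlgebra N) i, f x i = x 0 * f (e 0) i + x 1 * f (e 1) i := by
    intro x i
    rw [hval x, MSCAlgebra.add_apply, MSCAlgebra.smul_apply, MSCAlgebra.smul_apply]
  have hm : ∀ j k i, f (e j * e k) i = (f (e j) * f (e k)) i := by
    intro j k i
    rw [map_mul]
  simp only [MSCAlgebra.mul_apply, hv (_ * _)] at hm
  refine ⟨f (e 0) 0, f (e 1) 0, f (e 0) 1, f (e 1) 1, ?_, ?_, ?_, ?_, ?_, ?_, ?_, ?_, ?_⟩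
  -- If the determinant were zero, both columns of the adjugate would lie in the kernel of `f`. By
  -- injectivity all entries of the matrix vanish, and then the first basis vector is itself in the
  -- kernel.
  · intro hd
    have key : ∀ x y : F, x * f (e 0) 0 + y * f (e 1) 0 = 0 → x * f (e 0) 1 + y * f (e 1) 1 = 0 →
        x = 0 ∧ y = 0 := by
      intro x y h0 h1
      have : (MSCAlgebra.mk x y : MSCAlgebra N) = 0 := by
        apply hf.1
        rw [map_zero]
        funext i
        rw [hv, MSCAlgebra.zero_apply]
        fin_cases i
        · exact h0
        · exact h1
      exact ⟨congrFun this 0, congrFun this 1⟩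
    obtain ⟨h1, h2⟩ := key (f (e 1) 1) (-f (e 0) 1) (by linear_combination hd) (by ring)
    obtain ⟨h3, h4⟩ := key (f (e 1) 0) (-f (e 0) 0) (by ring) (by linear_combination -hd)
    have := (key 1 0 (by linear_combination -h4) (by linear_combination -h2)).1
    exact one_ne_zero this
  · have := hm 0 0 0; simp [h00, h01] at this; linear_combination -this
  · have := hm 0 0 1; simp [h00, h01] at this; linear_combination -this
  · have := hm 0 1 0; simp [h00, h01, h10, h11] at this; linear_combination -this
  · have := hm 0 1 1; simp [h00, h01, h10, h11] at this; linear_combination -this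
  · have := hm 1 0 0; simp [h00, h01, h10, h11] at this; linear_combination -this
  · have := hm 1 0 1; simp [h00, h01, h10, h11] at this; linear_combination -this
  · have := hm 1 1 0; simp [h10, h11] at this; linear_combination -this
  · have := hm 1 1 1; simp [h10, h11] at this; linear_combination -this

namespace IsChange

variable {N M : MSC F} {a b c d : F}

/-- The trace of left multiplication by `u` does not depend on the basis and is linear in `u`.
Computed in the basis `u, v` it satisfies `det(u, v) · tr = det(uu, v) + det(u, uv)`, which is the
combination used. The next three lemmas treat `v` and right multiplication alike. -/
theorem left_trace_fst (h : IsChange N M a b c d) :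
    N 0 0 + N 1 1 = (M 0 0 + M 1 1) * a + (M 0 2 + M 1 3) * c := by
  apply mul_left_cancel₀ h.det
  linear_combination -d * h.uu0 + b * h.uu1 - a * h.uv1 + c * h.uv0

theorem left_trace_snd (h : IsChange N M a b c d) :
    N 0 2 + N 1 3 = (M 0 0 + M 1 1) * b + (M 0 2 + M 1 3) * d := by
  apply mul_left_cancel₀ h.det
  linear_combination -d * h.vu0 + b * h.vu1 - a * h.vv1 + c * h.vv0

theorem right_trace_fst (h : IsChange N M a b c d) :
    N 0 0 + N 1 2 = (M 0 0 + M 1 2) * a + (M 0 1 + M 1 3) * c := by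
  apply mul_left_cancel₀ h.det
  linear_combination -d * h.uu0 + b * h.uu1 - a * h.vu1 + c * h.vu0

theorem right_trace_snd (h : IsChange N M a b c d) :
    N 0 1 + N 1 3 = (M 0 0 + M 1 2) * b + (M 0 1 + M 1 3) * d := by
  apply mul_left_cancel₀ h.det
  linear_combination -d * h.uv0 + b * h.uv1 - a * h.vv1 + c * h.vv0

end IsChange

/-- Cramer's rule gives the coordinates `P`, `Q` of each product in the new basis. -/
theorem exists_isChange (M : MSC F) {a b c d : F} (h : a * d - b * c ≠ 0) :
    ∃ N, IsChange N M a b c d := by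
  let X (i : Fin 2) (x y x' y' : F) : F :=
    M i 0 * (x * x') + M i 1 * (x * y') + M i 2 * (y * x') + M i 3 * (y * y')
  let P (x y x' y' : F) : F := (d * X 0 x y x' y' - b * X 1 x y x' y') / (a * d - b * c)
  let Q (x y x' y' : F) : F := (a * X 1 x y x' y' - c * X 0 x y x' y') / (a * d - b * c)
  have h0 : ∀ x y x' y', X 0 x y x' y' = P x y x' y' * a + Q x y x' y' * b := by
    intro x y x' y'
    simp only [P, Q]
    rw [div_mul_eq_mul_div, div_mul_eq_mul_div, ← add_div, eq_div_iff h]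
    ring
  have h1 : ∀ x y x' y', X 1 x y x' y' = P x y x' y' * c + Q x y x' y' * d := by
    intro x y x' y'
    simp only [P, Q]
    rw [div_mul_eq_mul_div, div_mul_eq_mul_div, ← add_div, eq_div_iff h]
    ring
  exact ⟨!![P a c a c, P a c b d, P b d a c, P b d b d; Q a c a c, Q a c b d, Q b d a c, Q b d b d],
    h, h0 _ _ _ _, h1 _ _ _ _, h0 _ _ _ _, h1 _ _ _ _, h0 _ _ _ _, h1 _ _ _ _, h0 _ _ _ _,
    h1 _ _ _ _⟩

end Iso

/-! ### One-dimensional subalgebras as zeros of a cubic on the projective line -/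

section Count

variable {F : Type u} [Field F]

/-- The line through `(1, y)`, or through `(0, 1)` for `none`. -/
def line (M : MSC F) : Option F → Submodule F (MSCAlgebra M)
  | some y => Submodule.span F {MSCAlgebra.mk 1 y}
  | none => Submodule.span F {MSCAlgebra.mk 0 1}

theorem mem_line_some {M : MSC F} {y : F} {x : MSCAlgebra M} :
    x ∈ line M (some y) ↔ x 1 = x 0 * y := by
  rw [line, Submodule.mem_span_singleton]
  constructor
  · rintro ⟨c, rfl⟩
    simp [MSCAlgebra.smul_apply]
  · intro h
    refine ⟨x 0, ?_⟩
    funext i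
    fin_cases i <;> simp [MSCAlgebra.smul_apply, h]

theorem mem_line_none {M : MSC F} {x : MSCAlgebra M} :
    x ∈ line M none ↔ x 0 = 0 := by
  rw [line, Submodule.mem_span_singleton]
  constructor
  · rintro ⟨c, rfl⟩
    simp [MSCAlgebra.smul_apply]
  · intro h
    refine ⟨x 1, ?_⟩
    funext i
    fin_cases i <;> simp [MSCAlgebra.smul_apply, h]

theorem line_injective (M : MSC F) : Function.Injective (line M) := by
  have hs : ∀ y, (MSCAlgebra.mk 1 y : MSCAlgebra M) ∈ line M (some y) := fun y => by
    simp [mem_line_some]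
  intro s t h
  rcases s with _ | y <;> rcases t with _ | z
  · rfl
  · have := hs z
    rw [← h, mem_line_none] at this
    simp at this
  · have := hs y
    rw [h, mem_line_none] at this
    simp at this
  · have := hs y
    rw [h, mem_line_some] at this
    simpa using this

theorem finrank_line (M : MSC F) (t : Option F) : finrank F (line M t) = 1 := by
  rcases t with _ | y
  · refine finrank_span_singleton fun h => ?_
    exact one_ne_zero (congrFun h 1)
  · refine finrank_span_singleton fun h => ?_
    exact one_ne_zero (congrFun h 0)

theorem exists_eq_line {M : MSC F} {S : Submodule F (MSCAlgebra M)} (h : finrank F S = 1) :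
    ∃ t, S = line M t := by
  obtain ⟨⟨x, hxS⟩, hx0, hx⟩ := finrank_eq_one_iff'.1 h
  have hS : ∀ z, z ∈ S ↔ ∃ c : F, c • x = z := by
    intro z
    constructor
    · intro hz
      obtain ⟨c, hc⟩ := hx ⟨z, hz⟩
      exact ⟨c, congrArg Subtype.val hc⟩
    · rintro ⟨c, rfl⟩
      exact S.smul_mem c hxS
  by_cases h0 : x 0 = 0
  · have h1 : x 1 ≠ 0 := by
      intro h1
      apply hx0
      ext
      funext i
      fin_cases i
      · exact h0
      · exact h1
    refine ⟨none, Submodule.ext fun z => ?_⟩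
    rw [hS, mem_line_none]
    constructor
    · rintro ⟨c, rfl⟩
      simp [MSCAlgebra.smul_apply, h0]
    · intro hz
      refine ⟨z 1 / x 1, ?_⟩
      funext i
      fin_cases i
      · simp [MSCAlgebra.smul_apply, h0, hz]
      · simp [MSCAlgebra.smul_apply, h1]
  · refine ⟨some (x 1 / x 0), Submodule.ext fun z => ?_⟩
    rw [hS, mem_line_some]
    constructor
    · rintro ⟨c, rfl⟩
      simp only [MSCAlgebra.smul_apply]
      field_simp
    · intro hz
      refine ⟨z 0 / x 0, ?_⟩
      funext i
      fin_cases i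
      · simp [MSCAlgebra.smul_apply, h0]
      · simp only [MSCAlgebra.smul_apply, Fin.mk_one, hz]
        field_simp

/-- All products within a line are multiples of the square of its generator, so only that square has
to be tested. -/
theorem line_some_mul_mem_iff {M : MSC F} {y : F} :
    (∀ u ∈ line M (some y), ∀ v ∈ line M (some y), u * v ∈ line M (some y)) ↔ M.p y = 0 := by
  simp only [mem_line_some, MSCAlgebra.mul_apply, MSC.p]
  constructor
  · intro h
    have := h (MSCAlgebra.mk 1 y) (by simp) (MSCAlgebra.mk 1 y) (by simp)
    simp only [MSCAlgebra.mk_zero, MSCAlgebra.mk_one] at this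
    linear_combination -this
  · intro h u hu v hv
    rw [hu, hv]
    linear_combination -u 0 * v 0 * h

theorem line_none_mul_mem_iff {M : MSC F} :
    (∀ u ∈ line M none, ∀ v ∈ line M none, u * v ∈ line M none) ↔ M 0 3 = 0 := by
  simp only [mem_line_none, MSCAlgebra.mul_apply]
  constructor
  · intro h
    simpa using h (MSCAlgebra.mk 0 1) (by simp) (MSCAlgebra.mk 0 1) (by simp)
  · intro h u hu v hv
    simp [hu, hv, h]

/-- `Option F` serves as the projective line, `none` being the point at infinity. That point is a
zero of the cubic form exactly when the leading coefficient `α₄` of `p` vanishes, whence the extra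
1. -/
theorem numSubalgebras_MSCAlgebra (M : MSC F) [Decidable (M 0 3 = 0)] :
    numSubalgebras F (MSCAlgebra M) = {y | M.p y = 0}.encard + if M 0 3 = 0 then 1 else 0 := by
  let T : Set (Option F) := some '' {y | M.p y = 0} ∪ {t | t = none ∧ M 0 3 = 0}
  have hT : ∀ t, t ∈ T ↔ ∀ u ∈ line M t, ∀ v ∈ line M t, u * v ∈ line M t := by
    intro t
    rcases t with _ | y
    · rw [line_none_mul_mem_iff]
      simp [T]
    · rw [line_some_mul_mem_iff]
      simp [T]
  have himg : NonUnitalSubalgebra.toSubmodule ''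
      {S : NonUnitalSubalgebra F (MSCAlgebra M) | finrank F S = 1} = line M '' T := by
    ext W
    constructor
    · rintro ⟨S, hS, rfl⟩
      obtain ⟨t, ht⟩ := exists_eq_line (S := S.toSubmodule) hS
      refine ⟨t, ?_, ht.symm⟩
      rw [hT, ← ht]
      exact fun u hu v hv => S.mul_mem hu hv
    · rintro ⟨t, ht, rfl⟩
      rw [hT] at ht
      exact ⟨{ line M t with mul_mem' := fun {u v} hu hv => ht u hu v hv }, finrank_line M t, rfl⟩
  rw [numSubalgebras, ← NonUnitalSubalgebra.toSubmodule_injective.encard_image, himg,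
    (line_injective M).encard_image, Set.encard_union_eq, (Option.some_injective F).encard_image]
  · congr 1
    split_ifs with h
    · simp [h]
    · simp [h]
  · rw [Set.disjoint_left]
    rintro _ ⟨y, _, rfl⟩ ⟨h, _⟩
    cases h

end Count

/-! ### Numbers of distinct roots of polynomials of degree at most three -/

section Roots

variable {F : Type u} [Field F]

theorem exists_root_quadratic
    (hroot : ∀ q : Polynomial F, q.natDegree = 2 ∨ q.natDegree = 3 → ∃ x : F, q.IsRoot x)
    {a : F} (ha : a ≠ 0) (b c : F) : ∃ x, a * x ^ 2 + b * x + c = 0 := by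
  obtain ⟨x, hx⟩ := hroot _ (Or.inl (Polynomial.natDegree_quadratic (b := b) (c := c) ha))
  exact ⟨x, by simpa using hx⟩

theorem exists_root_cubic
    (hroot : ∀ q : Polynomial F, q.natDegree = 2 ∨ q.natDegree = 3 → ∃ x : F, q.IsRoot x)
    {a : F} (ha : a ≠ 0) (b c d : F) : ∃ x, a * x ^ 3 + b * x ^ 2 + c * x + d = 0 := by
  obtain ⟨x, hx⟩ := hroot _ (Or.inr (Polynomial.natDegree_cubic (b := b) (c := c) (d := d) ha))
  exact ⟨x, by simpa using hx⟩

theorem exists_sq_eq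
    (hroot : ∀ q : Polynomial F, q.natDegree = 2 ∨ q.natDegree = 3 → ∃ x : F, q.IsRoot x)
    (x : F) : ∃ s : F, s ^ 2 = x := by
  obtain ⟨s, hs⟩ := exists_root_quadratic hroot one_ne_zero 0 (-x)
  exact ⟨s, by linear_combination hs⟩

/-- Squaring is surjective, so on a finite field it would be injective, against `1 ^ 2 = (-1) ^ 2`.
-/
theorem infinite_of_hroot
    (hroot : ∀ q : Polynomial F, q.natDegree = 2 ∨ q.natDegree = 3 → ∃ x : F, q.IsRoot x)
    (h2 : (2 : F) ≠ 0) : Infinite F := by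
  by_contra h
  have : Finite F := not_infinite_iff_finite.1 h
  have hs : Function.Surjective fun x : F => x ^ 2 := exists_sq_eq hroot
  have h1 : (1 : F) = -1 := Finite.injective_iff_surjective.2 hs (by simp)
  exact h2 (by linear_combination h1)

theorem exists_factorization_quadratic
    (hroot : ∀ q : Polynomial F, q.natDegree = 2 ∨ q.natDegree = 3 → ∃ x : F, q.IsRoot x)
    {a : F} (ha : a ≠ 0) (b c : F) : ∃ r s, b = -a * (r + s) ∧ c = a * (r * s) := by
  obtain ⟨r, hr⟩ := exists_root_quadratic hroot ha b c
  refine ⟨r, -b / a - r, by field_simp; ring, ?_⟩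
  field_simp
  linear_combination hr

theorem exists_factorization_cubic
    (hroot : ∀ q : Polynomial F, q.natDegree = 2 ∨ q.natDegree = 3 → ∃ x : F, q.IsRoot x)
    {a : F} (ha : a ≠ 0) (b c d : F) :
    ∃ r s t, b = -a * (r + s + t) ∧ c = a * (r * s + s * t + r * t) ∧ d = -a * (r * s * t) := by
  obtain ⟨r, hr⟩ := exists_root_cubic hroot ha b c d
  obtain ⟨s, t, h1, h2⟩ := exists_factorization_quadratic hroot ha (b + a * r)
    (c + b * r + a * r ^ 2)
  refine ⟨r, s, t, by linear_combination h1, by linear_combination h2 - r * h1, ?_⟩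
  linear_combination hr - r * h2

theorem encard_roots_const {q : F → F} {d : F} (hd : d ≠ 0) (hq : ∀ y, q y = d) :
    {y | q y = 0}.encard = 0 := by
  simp [hq, hd]

theorem encard_roots_linear {q : F → F} {c d : F} (hc : c ≠ 0) (hq : ∀ y, q y = c * y + d) :
    {y | q y = 0}.encard = 1 := by
  rw [Set.encard_eq_one]
  refine ⟨-d / c, Set.ext fun y => ?_⟩
  simp only [hq, Set.mem_ofPred_eq, Set.mem_singleton_iff, eq_div_iff hc]
  constructor <;> intro h <;> linear_combination h

theorem encard_roots_quadratic_eq_one {q : F → F} {b c d : F} (h2 : (2 : F) ≠ 0) (hb : b ≠ 0)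
    (hdisc : c ^ 2 - 4 * b * d = 0) (hq : ∀ y, q y = b * y ^ 2 + c * y + d) :
    {y | q y = 0}.encard = 1 := by
  rw [Set.encard_eq_one]
  refine ⟨-c / (2 * b), Set.ext fun y => ?_⟩
  simp only [hq, Set.mem_ofPred_eq, Set.mem_singleton_iff, eq_div_iff (mul_ne_zero h2 hb)]
  constructor
  · intro h
    have : (y * (2 * b) + c) ^ 2 = 0 := by linear_combination 4 * b * h + hdisc
    linear_combination pow_eq_zero_iff two_ne_zero |>.1 this
  · intro h
    have h4 : (4 : F) * b ≠ 0 := by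
      have : (4 : F) = 2 * 2 := by norm_num
      rw [this]
      exact mul_ne_zero (mul_ne_zero h2 h2) hb
    apply mul_left_cancel₀ h4
    linear_combination (y * (2 * b) + c) * h - hdisc

theorem encard_roots_quadratic_eq_two
    (hroot : ∀ q : Polynomial F, q.natDegree = 2 ∨ q.natDegree = 3 → ∃ x : F, q.IsRoot x)
    {q : F → F} {b c d : F} (hb : b ≠ 0)
    (hdisc : c ^ 2 - 4 * b * d ≠ 0) (hq : ∀ y, q y = b * y ^ 2 + c * y + d) :
    {y | q y = 0}.encard = 2 := by
  obtain ⟨r, s, rfl, rfl⟩ := exists_factorization_quadratic hroot hb c d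
  rw [Set.encard_eq_two]
  refine ⟨r, s, ?_, Set.ext fun y => ?_⟩
  · rintro rfl
    exact hdisc (by ring)
  · have : q y = b * ((y - r) * (y - s)) := by rw [hq]; ring
    simp [this, hb, sub_eq_zero]

/-- The two coefficient conditions make `27 a² q(y)` the perfect cube `(3 a y + b) ^ 3`. -/
theorem encard_roots_cubic_eq_one {q : F → F} {a b c d : F} (h3 : (3 : F) ≠ 0) (ha : a ≠ 0)
    (h1 : b ^ 2 - 3 * a * c = 0) (h0 : b ^ 3 = 27 * a ^ 2 * d)
    (hq : ∀ y, q y = a * y ^ 3 + b * y ^ 2 + c * y + d) :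
    {y | q y = 0}.encard = 1 := by
  rw [Set.encard_eq_one]
  refine ⟨-b / (3 * a), Set.ext fun y => ?_⟩
  simp only [hq, Set.mem_ofPred_eq, Set.mem_singleton_iff, eq_div_iff (mul_ne_zero h3 ha)]
  have key : (3 * a * y + b) ^ 3 = 27 * a ^ 2 * (a * y ^ 3 + b * y ^ 2 + c * y + d) := by
    linear_combination (9 * a * y) * h1 + h0
  have h27 : (27 : F) * a ^ 2 ≠ 0 := by
    have : (27 : F) = 3 ^ 3 := by norm_num
    rw [this]
    exact mul_ne_zero (pow_ne_zero _ h3) (pow_ne_zero _ ha)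
  constructor
  · intro h
    rw [h, mul_zero] at key
    linear_combination pow_eq_zero_iff three_ne_zero |>.1 key
  · intro h
    apply mul_left_cancel₀ h27
    rw [← key, mul_zero, pow_eq_zero_iff three_ne_zero]
    linear_combination h

/-- The product of the two critical values of a cubic, in terms of its roots. -/
theorem critical_values_mul {a b c d r s t w : F} (h3 : (3 : F) ≠ 0) (ha : a ≠ 0)
    (hb : b = -a * (r + s + t)) (hc : c = a * (r * s + s * t + r * t))
    (hd : d = -a * (r * s * t)) (hw : w ^ 2 = b ^ 2 - 3 * a * c) {y z : F}
    (hy : y * (3 * a) = -b - w) (hz : z * (3 * a) = -b + w) :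
    27 * ((a * y ^ 3 + b * y ^ 2 + c * y + d) * (a * z ^ 3 + b * z ^ 2 + c * z + d)) =
      -a ^ 2 * ((r - s) * (s - t) * (r - t)) ^ 2 := by
  have h27 : (27 : F) * a ^ 2 ≠ 0 := by
    have : (27 : F) = 3 ^ 3 := by norm_num
    rw [this]
    exact mul_ne_zero (pow_ne_zero _ h3) (pow_ne_zero _ ha)
  -- Value of the cubic at a critical point `(-b + v) / (3a)`, reduced with `v ^ 2 = b ^ 2 - 3ac`.
  -- The two values differ only in the sign of `v`, so their product is a difference of squares.
  have h9 : ∀ x v : F, v ^ 2 = b ^ 2 - 3 * a * c → x * (3 * a) = -b + v →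
      27 * a ^ 2 * (a * x ^ 3 + b * x ^ 2 + c * x + d) =
        2 * b ^ 3 - 9 * a * b * c + 27 * a ^ 2 * d - 2 * v * (b ^ 2 - 3 * a * c) := by
    intro x v hv hx
    have hv' : v = x * (3 * a) + b := by linear_combination -hx
    rw [hv'] at hv ⊢
    linear_combination (x * (3 * a) - 2 * b + 3 * b) * hv
  have e1 := h9 y (-w) (by rw [neg_sq, hw]) (by rw [hy]; ring)
  have e2 := h9 z w hw hz
  apply mul_left_cancel₀ h27
  apply mul_left_cancel₀ (pow_ne_zero 2 ha)
  have e3 := congrArg₂ (· * ·) e1 e2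
  -- The classical expression of the discriminant through the covariants of the cubic.
  have e4 : (2 * b ^ 3 - 9 * a * b * c + 27 * a ^ 2 * d) ^ 2 - 4 * (b ^ 2 - 3 * a * c) ^ 3
      = - 27 * a ^ 6 * ((r - s) * (s - t) * (r - t)) ^ 2 := by
    rw [hb, hc, hd]; ring
  linear_combination e3 + e4 - 4 * (b ^ 2 - 3 * a * c) ^ 2 * hw

section Cubic

variable {q : F → F} {a b c d w y z : F}

theorem encard_roots_cubic_eq_three
    (hroot : ∀ q : Polynomial F, q.natDegree = 2 ∨ q.natDegree = 3 → ∃ x : F, q.IsRoot x)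
    (h3 : (3 : F) ≠ 0) (ha : a ≠ 0) (hw : w ^ 2 = b ^ 2 - 3 * a * c)
    (hy : y * (3 * a) = -b - w) (hz : z * (3 * a) = -b + w)
    (hq : ∀ y, q y = a * y ^ 3 + b * y ^ 2 + c * y + d) (hcrit : q y * q z ≠ 0) :
    {y | q y = 0}.encard = 3 := by
  obtain ⟨r, s, t, hb, hc, hd⟩ := exists_factorization_cubic hroot ha b c d
  have key := critical_values_mul h3 ha hb hc hd hw hy hz
  rw [← hq, ← hq] at key
  have h27 : (27 : F) ≠ 0 := by
    have : (27 : F) = 3 ^ 3 := by norm_num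
    rw [this]
    exact pow_ne_zero _ h3
  have hne : ((r - s) * (s - t) * (r - t)) ≠ 0 := by
    intro h
    rw [h] at key
    simp only [ne_eq, OfNat.ofNat_ne_zero, not_false_eq_true, zero_pow, mul_zero, mul_eq_zero,
      h27, false_or] at key
    exact hcrit (mul_eq_zero.2 key)
  simp only [ne_eq, mul_eq_zero, sub_eq_zero, not_or] at hne
  rw [Set.encard_eq_three]
  refine ⟨r, s, t, hne.1.1, hne.2, hne.1.2, Set.ext fun x => ?_⟩
  have : q x = a * ((x - r) * ((x - s) * (x - t))) := by rw [hq, hb, hc, hd]; ring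
  simp [this, ha, sub_eq_zero]

theorem encard_roots_cubic_eq_two
    (hroot : ∀ q : Polynomial F, q.natDegree = 2 ∨ q.natDegree = 3 → ∃ x : F, q.IsRoot x)
    (h3 : (3 : F) ≠ 0) (ha : a ≠ 0) (hw : w ^ 2 = b ^ 2 - 3 * a * c)
    (hy : y * (3 * a) = -b - w) (hz : z * (3 * a) = -b + w)
    (hq : ∀ y, q y = a * y ^ 3 + b * y ^ 2 + c * y + d) (hcrit : q y * q z = 0)
    (hne : b ^ 2 - 3 * a * c ≠ 0) :
    {y | q y = 0}.encard = 2 := by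
  obtain ⟨r, s, t, hb, hc, hd⟩ := exists_factorization_cubic hroot ha b c d
  have key := critical_values_mul h3 ha hb hc hd hw hy hz
  rw [← hq, ← hq, hcrit] at key
  have h0 : ((r - s) * (s - t) * (r - t)) = 0 := by
    have : a ^ 2 * ((r - s) * (s - t) * (r - t)) ^ 2 = 0 := by linear_combination key
    simpa [ha] using this
  have hf : ∀ x, q x = a * ((x - r) * ((x - s) * (x - t))) := fun x => by
    rw [hq, hb, hc, hd]; ring
  -- A triple root would force `b ^ 2 = 3ac`.
  have hn : ¬(r = s ∧ s = t) := by
    rintro ⟨rfl, rfl⟩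
    exact hne (by rw [hb, hc]; ring)
  simp only [mul_eq_zero, sub_eq_zero] at h0
  rw [Set.encard_eq_two]
  rcases h0 with (rfl | rfl) | rfl
  · exact ⟨r, t, fun h => hn ⟨rfl, h⟩, Set.ext fun x => by simp [hf, ha, sub_eq_zero]⟩
  · exact ⟨r, s, fun h => hn ⟨h, rfl⟩, Set.ext fun x => by simp [hf, ha, sub_eq_zero]⟩
  · refine ⟨r, s, fun h => hn ⟨h, h.symm⟩, Set.ext fun x => ?_⟩
    simp [hf, ha, sub_eq_zero]
    tauto

end Cubic

end Roots

/-! ### Numbers of subalgebras in the canonical families -/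

section Lists

variable {F : Type u} [Field F]

theorem numSubalgebras_of_ne {M : MSC F} (h : M 0 3 ≠ 0) :
    numSubalgebras F (MSCAlgebra M) = {y | M.p y = 0}.encard := by
  classical
  rw [numSubalgebras_MSCAlgebra, if_neg h, add_zero]

theorem numSubalgebras_of_eq {M : MSC F} (h : M 0 3 = 0) :
    numSubalgebras F (MSCAlgebra M) = {y | M.p y = 0}.encard + 1 := by
  classical
  rw [numSubalgebras_MSCAlgebra, if_pos h]

theorem numSubalgebras_const {M : MSC F} {d : F} (h : M 0 3 = 0) (hd : d ≠ 0)
    (hq : ∀ y, M.p y = d) : numSubalgebras F (MSCAlgebra M) = 1 := by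
  rw [numSubalgebras_of_eq h, encard_roots_const hd hq, zero_add]

theorem numSubalgebras_linear {M : MSC F} {c d : F} (h : M 0 3 = 0) (hc : c ≠ 0)
    (hq : ∀ y, M.p y = c * y + d) : numSubalgebras F (MSCAlgebra M) = 2 := by
  rw [numSubalgebras_of_eq h, encard_roots_linear hc hq, one_add_one_eq_two]

theorem numSubalgebras_quadratic_eq_two {M : MSC F} {b c d : F} (h2 : (2 : F) ≠ 0)
    (h : M 0 3 = 0) (hb : b ≠ 0) (hdisc : c ^ 2 - 4 * b * d = 0)
    (hq : ∀ y, M.p y = b * y ^ 2 + c * y + d) : numSubalgebras F (MSCAlgebra M) = 2 := by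
  rw [numSubalgebras_of_eq h, encard_roots_quadratic_eq_one h2 hb hdisc hq, one_add_one_eq_two]

theorem numSubalgebras_quadratic_eq_three
    (hroot : ∀ q : Polynomial F, q.natDegree = 2 ∨ q.natDegree = 3 → ∃ x : F, q.IsRoot x)
    {M : MSC F} {b c d : F} (h : M 0 3 = 0) (hb : b ≠ 0) (hdisc : c ^ 2 - 4 * b * d ≠ 0)
    (hq : ∀ y, M.p y = b * y ^ 2 + c * y + d) : numSubalgebras F (MSCAlgebra M) = 3 := by
  rw [numSubalgebras_of_eq h, encard_roots_quadratic_eq_two hroot hb hdisc hq, two_add_one_eq_three]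

theorem numSubalgebras_zero [Infinite F] {M : MSC F} (h : M 0 3 = 0)
    (hq : ∀ y, M.p y = 0) : numSubalgebras F (MSCAlgebra M) = ⊤ := by
  rw [numSubalgebras_of_eq h]
  simp [hq]

namespace CanonicalForm

section Polynomials

variable (α₁ α₂ α₄ β₁ β₂ y : F)

theorem p_of (a b c d a' b' c' d' : F) : MSC.p !![a, b, c, d; a', b', c', d'] y =
    d * y ^ 3 + (b + c - d') * y ^ 2 + (a - b' - c') * y - a' := rfl

theorem p_A1 : (A1 α₁ α₂ α₄ β₁).msc.p y =
    α₄ * y ^ 3 + (3 * α₂ + 1) * y ^ 2 + (3 * α₁ - 1) * y + -β₁ := by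
  rw [msc, p_of]; ring

theorem p_A2 : (A2 α₁ β₁ β₂).msc.p y =
    1 * y ^ 3 + 0 * y ^ 2 + (2 * α₁ - 1 - β₂) * y + -β₁ := by
  rw [msc, p_of]; ring

theorem p_A3 : (A3 β₁ β₂).msc.p y = 3 * y ^ 2 + (-(β₂ + 1)) * y + -β₁ := by
  rw [msc, p_of]; ring

theorem p_A4 : (A4 α₁ β₂).msc.p y = (2 * α₁ - 1 - β₂) * y + 0 := by
  rw [msc, p_of]; ring

theorem p_A5 : (A5 α₁).msc.p y = -1 := by
  rw [msc, p_of]; ring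

theorem p_A6 : (A6 α₁ β₁).msc.p y =
    1 * y ^ 3 + 0 * y ^ 2 + (3 * α₁ - 1) * y + -β₁ := by
  rw [msc, p_of]; ring

theorem p_A7 : (A7 β₁).msc.p y = 3 * y ^ 2 + (-1) * y + -β₁ := by
  rw [msc, p_of]; ring

theorem p_A8 : (A8 α₁).msc.p y = (3 * α₁ - 1) * y + 0 := by
  rw [msc, p_of]; ring

theorem p_A9 (h3 : (3 : F) ≠ 0) : (A9 : CanonicalForm F).msc.p y = -1 := by
  rw [msc, p_of]; field_simp; ring

theorem p_A10 : (A10 : CanonicalForm F).msc.p y = 3 * y ^ 2 + 0 * y + 0 := by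
  rw [msc, p_of]; ring

theorem p_A11 : (A11 : CanonicalForm F).msc.p y = 3 * y ^ 2 + 0 * y + -1 := by
  rw [msc, p_of]; ring

theorem p_A12 : (A12 : CanonicalForm F).msc.p y = -1 := by
  rw [msc, p_of]; ring

end Polynomials

theorem numSubalgebras_of_oneList (h3 : (3 : F) ≠ 0) {c : CanonicalForm F} (h : c.OneList) :
    numSubalgebras F c.Alg = 1 := by
  have h9 : (9 : F) ≠ 0 := by
    have : (9 : F) = 3 ^ 2 := by norm_num
    rw [this]; exact pow_ne_zero _ h3
  have h27 : (27 : F) ≠ 0 := by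
    have : (27 : F) = 3 ^ 3 := by norm_num
    rw [this]; exact pow_ne_zero _ h3
  have hm1 : (-1 : F) ≠ 0 := neg_ne_zero.2 one_ne_zero
  cases c with
  | A1 α₁ α₂ α₄ β₁ =>
    rcases h with ⟨h4, h1, hβ⟩ | ⟨rfl, rfl, rfl, hβ⟩
    · refine (numSubalgebras_of_ne h4).trans
        (encard_roots_cubic_eq_one h3 h4 ?_ ?_ (p_A1 α₁ α₂ α₄ β₁))
      · rw [h1]; field_simp; ring
      · rw [hβ]; field_simp
    · refine numSubalgebras_const rfl (neg_ne_zero.2 hβ) fun y => ?_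
      rw [p_A1]; field_simp; ring
  | A2 α₁ β₁ β₂ =>
    obtain ⟨rfl, rfl⟩ := h
    exact (numSubalgebras_of_ne one_ne_zero).trans
      (encard_roots_cubic_eq_one h3 one_ne_zero (by ring) (by ring) (p_A2 α₁ 0 (2 * α₁ - 1)))
  | A3 _ _ => exact h.elim
  | A4 _ _ => exact h.elim
  | A5 α₁ => exact numSubalgebras_const rfl hm1 (p_A5 α₁)
  | A6 α₁ β₁ =>
    obtain ⟨rfl, rfl⟩ := h
    exact (numSubalgebras_of_ne one_ne_zero).trans
      (encard_roots_cubic_eq_one h3 one_ne_zero (by field_simp; ring) (by ring) (p_A6 (1 / 3) 0))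
  | A7 _ => exact h.elim
  | A8 _ => exact h.elim
  | A9 => exact numSubalgebras_const rfl hm1 fun y => p_A9 y h3
  | A10 => exact h.elim
  | A11 => exact h.elim
  | A12 => exact numSubalgebras_const rfl hm1 p_A12

theorem numSubalgebras_of_twoList
    (hroot : ∀ q : Polynomial F, q.natDegree = 2 ∨ q.natDegree = 3 → ∃ x : F, q.IsRoot x)
    (h2 : (2 : F) ≠ 0) (h3 : (3 : F) ≠ 0) {c : CanonicalForm F} (h : c.TwoList) :
    numSubalgebras F c.Alg = 2 := by
  have h9 : (9 : F) ≠ 0 := by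
    have : (9 : F) = 3 ^ 2 := by norm_num
    rw [this]; exact pow_ne_zero _ h3
  have h12 : (12 : F) ≠ 0 := by
    have : (12 : F) = 2 ^ 2 * 3 := by norm_num
    rw [this]; exact mul_ne_zero (pow_ne_zero _ h2) h3
  cases c with
  | A1 α₁ α₂ α₄ β₁ =>
    rcases h with ⟨h4, h1, hcrit⟩ | ⟨rfl, hα, hd⟩ | ⟨rfl, h1, rfl⟩
    · refine (numSubalgebras_of_ne h4).trans
        (encard_roots_cubic_eq_two hroot h3 h4 (sqrtOf_sq (exists_sq_eq hroot _))
          (div_mul_cancel₀ _ (mul_ne_zero h3 h4)) (div_mul_cancel₀ _ (mul_ne_zero h3 h4))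
          (p_A1 α₁ α₂ α₄ β₁) hcrit fun h0 => h1 ?_)
      field_simp
      linear_combination (-3) * h0
    · refine numSubalgebras_quadratic_eq_two (b := 3 * α₂ + 1) (c := 3 * α₁ - 1) (d := -β₁)
        h2 rfl (fun h0 => hα ?_) (by linear_combination hd) fun y => ?_
      · field_simp
        linear_combination h0
      · rw [p_A1]; ring
    · refine numSubalgebras_linear (c := 3 * α₁ - 1) (d := -β₁) rfl (fun h0 => h1 ?_) fun y => ?_
      · field_simp
        linear_combination h0
      · rw [p_A1]; field_simp; ring
  | A2 α₁ β₁ β₂ =>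
    obtain ⟨h1, hcrit⟩ := h
    refine (numSubalgebras_of_ne one_ne_zero).trans
      (encard_roots_cubic_eq_two hroot h3 one_ne_zero
        ((sqrtOf_sq (exists_sq_eq hroot (3 * (1 + β₂ - 2 * α₁)))).trans (by ring))
        (by field_simp; ring) (by field_simp; ring) (p_A2 α₁ β₁ β₂) hcrit fun h0 => h1 ?_)
    apply mul_left_cancel₀ h3
    linear_combination h0
  | A3 β₁ β₂ =>
    refine numSubalgebras_quadratic_eq_two h2 rfl h3 ?_ (p_A3 β₁ β₂)
    rw [show β₁ = _ from h]
    field_simp; ring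
  | A4 α₁ β₂ => exact numSubalgebras_linear rfl (fun h0 => h (by linear_combination -h0)) (p_A4 _ _)
  | A5 α₁ => exact h.elim
  | A6 α₁ β₁ =>
    obtain ⟨h1, hcrit⟩ := h
    -- `crit6` has the two critical points in the opposite order of signs.
    rw [crit6, mul_comm] at hcrit
    refine (numSubalgebras_of_ne one_ne_zero).trans
      (encard_roots_cubic_eq_two hroot h3 one_ne_zero
        ((sqrtOf_sq (exists_sq_eq hroot (3 * (1 - 3 * α₁)))).trans (by ring))
        (by field_simp; ring) (by field_simp; ring) (p_A6 α₁ β₁) hcrit fun h0 => h1 ?_)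
    rw [eq_div_iff h3]
    apply mul_left_cancel₀ h3
    linear_combination -h0
  | A7 β₁ =>
    refine numSubalgebras_quadratic_eq_two h2 rfl h3 ?_ (p_A7 β₁)
    rw [show β₁ = _ from h]
    field_simp; ring
  | A8 α₁ =>
    refine numSubalgebras_linear rfl (fun h0 => h ?_) (p_A8 _)
    rw [eq_div_iff h3]
    linear_combination h0
  | A9 => exact h.elim
  | A10 => exact numSubalgebras_quadratic_eq_two h2 rfl h3 (by ring) p_A10
  | A11 => exact h.elim
  | A12 => exact h.elim

theorem numSubalgebras_of_threeList
    (hroot : ∀ q : Polynomial F, q.natDegree = 2 ∨ q.natDegree = 3 → ∃ x : F, q.IsRoot x)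
    (h2 : (2 : F) ≠ 0) (h3 : (3 : F) ≠ 0) {c : CanonicalForm F} (h : c.ThreeList) :
    numSubalgebras F c.Alg = 3 := by
  have h12 : (12 : F) ≠ 0 := by
    have : (12 : F) = 2 ^ 2 * 3 := by norm_num
    rw [this]; exact mul_ne_zero (pow_ne_zero _ h2) h3
  cases c with
  | A1 α₁ α₂ α₄ β₁ =>
    rcases h with ⟨h4, hcrit⟩ | ⟨rfl, hd⟩
    · exact (numSubalgebras_of_ne h4).trans
        (encard_roots_cubic_eq_three hroot h3 h4 (sqrtOf_sq (exists_sq_eq hroot _))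
          (div_mul_cancel₀ _ (mul_ne_zero h3 h4)) (div_mul_cancel₀ _ (mul_ne_zero h3 h4))
          (p_A1 α₁ α₂ α₄ β₁) hcrit)
    · obtain ⟨hα, hd⟩ := mul_ne_zero_iff.1 hd
      refine numSubalgebras_quadratic_eq_three hroot (b := 3 * α₂ + 1) (c := 3 * α₁ - 1) (d := -β₁)
        rfl hα (fun h0 => hd (by linear_combination h0)) fun y => ?_
      rw [p_A1]; ring
  | A2 α₁ β₁ β₂ =>
    exact (numSubalgebras_of_ne one_ne_zero).trans
      (encard_roots_cubic_eq_three hroot h3 one_ne_zero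
        ((sqrtOf_sq (exists_sq_eq hroot (3 * (1 + β₂ - 2 * α₁)))).trans (by ring))
        (by field_simp; ring) (by field_simp; ring) (p_A2 α₁ β₁ β₂) h)
  | A3 β₁ β₂ =>
    exact numSubalgebras_quadratic_eq_three hroot rfl h3 (fun h0 => h (by linear_combination h0))
      (p_A3 β₁ β₂)
  | A4 _ _ => exact h.elim
  | A5 _ => exact h.elim
  | A6 α₁ β₁ =>
    have hcrit : crit6 α₁ β₁ ≠ 0 := h
    rw [crit6, mul_comm] at hcrit
    exact (numSubalgebras_of_ne one_ne_zero).trans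
      (encard_roots_cubic_eq_three hroot h3 one_ne_zero
        ((sqrtOf_sq (exists_sq_eq hroot (3 * (1 - 3 * α₁)))).trans (by ring))
        (by field_simp; ring) (by field_simp; ring) (p_A6 α₁ β₁) hcrit)
  | A7 β₁ =>
    exact numSubalgebras_quadratic_eq_three hroot rfl h3 (fun h0 => h (by linear_combination h0))
      (p_A7 β₁)
  | A8 _ => exact h.elim
  | A9 => exact h.elim
  | A10 => exact h.elim
  | A11 =>
    exact numSubalgebras_quadratic_eq_three hroot rfl h3
      (fun h0 => h12 (by linear_combination h0)) p_A11
  | A12 => exact h.elim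

theorem numSubalgebras_of_infiniteList [Infinite F] (h3 : (3 : F) ≠ 0) {c : CanonicalForm F}
    (h : c.InfiniteList) : numSubalgebras F c.Alg = ⊤ := by
  cases c with
  | A1 α₁ α₂ α₄ β₁ =>
    obtain ⟨rfl, rfl, rfl, rfl⟩ := h
    refine numSubalgebras_zero rfl fun y => ?_
    rw [p_A1]; field_simp; ring
  | A4 α₁ β₂ =>
    refine numSubalgebras_zero rfl fun y => ?_
    rw [p_A4, show β₂ = _ from h]; ring
  | A8 α₁ =>
    refine numSubalgebras_zero rfl fun y => ?_
    rw [p_A8, show α₁ = _ from h]; field_simp; ring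
  | _ => exact h.elim

/-- Exhaustiveness is what later turns the one-way counts for the four lists into equivalences. The
delicate case is that of coinciding critical points, where a vanishing product of critical values
must give the exact value of `β₁` required for a triple root. -/
theorem mem_lists
    (hroot : ∀ q : Polynomial F, q.natDegree = 2 ∨ q.natDegree = 3 → ∃ x : F, q.IsRoot x)
    (h2 : (2 : F) ≠ 0) (h3 : (3 : F) ≠ 0) (c : CanonicalForm F) :
    c.OneList ∨ c.TwoList ∨ c.ThreeList ∨ c.InfiniteList := by
  have h9 : (9 : F) ≠ 0 := by
    have : (9 : F) = 3 ^ 2 := by norm_num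
    rw [this]; exact pow_ne_zero _ h3
  have h27 : (27 : F) ≠ 0 := by
    have : (27 : F) = 3 ^ 3 := by norm_num
    rw [this]; exact pow_ne_zero _ h3
  have h12 : (12 : F) ≠ 0 := by
    have : (12 : F) = 2 ^ 2 * 3 := by norm_num
    rw [this]; exact mul_ne_zero (pow_ne_zero _ h2) h3
  have hs0 : sqrtOf (0 : F) = 0 := by
    have := sqrtOf_sq (exists_sq_eq hroot (0 : F))
    simpa using this
  cases c with
  | A1 α₁ α₂ α₄ β₁ =>
    simp only [OneList, TwoList, ThreeList, InfiniteList]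
    by_cases h4 : α₄ = 0
    · subst h4
      by_cases hα : α₂ = -(1 / 3)
      · by_cases h1 : α₁ = 1 / 3
        · by_cases hβ : β₁ = 0 <;> simp [hα, h1, hβ]
        · exact Or.inr (Or.inl (Or.inr (Or.inr ⟨rfl, h1, hα⟩)))
      · have : 3 * α₂ + 1 ≠ 0 := fun h0 => hα (by field_simp; linear_combination h0)
        by_cases hd : (3 * α₁ - 1) ^ 2 + 4 * (3 * α₂ + 1) * β₁ = 0
        · exact Or.inr (Or.inl (Or.inr (Or.inl ⟨rfl, hα, hd⟩)))
        · exact Or.inr (Or.inr (Or.inl (Or.inr ⟨rfl, mul_ne_zero this hd⟩)))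
    · by_cases hcrit : crit1 α₁ α₂ α₄ β₁ = 0
      · by_cases h1 : α₁ = (3 * α₂ + 1) ^ 2 / (9 * α₄) + 1 / 3
        · refine Or.inl (Or.inl ⟨h4, h1, ?_⟩)
          have hw : (3 * α₂ + 1) ^ 2 - 3 * α₄ * (3 * α₁ - 1) = 0 := by
            rw [h1]; field_simp; ring
          -- The radicand is zero, so both critical points are `-(3α₂ + 1) / (3α₄)` and `crit1` is a
          -- square. Its vanishing determines `β₁`.
          rw [crit1, hw, hs0, sub_zero, add_zero, mul_self_eq_zero, p_A1,
            ← sub_eq_add_neg, sub_eq_zero] at hcrit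
          rw [← hcrit, h1]
          field_simp
          ring
        · exact Or.inr (Or.inl (Or.inl ⟨h4, h1, hcrit⟩))
      · exact Or.inr (Or.inr (Or.inl (Or.inl ⟨h4, hcrit⟩)))
  | A2 α₁ β₁ β₂ =>
    simp only [OneList, TwoList, ThreeList, InfiniteList]
    by_cases hcrit : crit2 α₁ β₁ β₂ = 0
    · by_cases h1 : β₂ = 2 * α₁ - 1
      · refine Or.inl ⟨?_, h1⟩
        rw [crit2, h1, show 3 * (1 + (2 * α₁ - 1) - 2 * α₁) = 0 by ring, hs0] at hcrit
        simpa [p_A2] using hcrit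
      · exact Or.inr (Or.inl ⟨h1, hcrit⟩)
    · exact Or.inr (Or.inr (Or.inl hcrit))
  | A3 β₁ β₂ =>
    by_cases h : (β₂ + 1) ^ 2 + 12 * β₁ = 0
    · refine Or.inr (Or.inl ?_)
      change β₁ = _
      field_simp
      linear_combination h
    · exact Or.inr (Or.inr (Or.inl h))
  | A4 α₁ β₂ =>
    by_cases h : β₂ = 2 * α₁ - 1
    · exact Or.inr (Or.inr (Or.inr h))
    · exact Or.inr (Or.inl h)
  | A5 _ => exact Or.inl trivial
  | A6 α₁ β₁ =>
    simp only [OneList, TwoList, ThreeList, InfiniteList]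
    by_cases hcrit : crit6 α₁ β₁ = 0
    · by_cases h1 : α₁ = 1 / 3
      · refine Or.inl ⟨h1, ?_⟩
        rw [crit6, h1, show 3 * (1 - 3 * (1 / 3)) = (0 : F) by field_simp; ring, hs0] at hcrit
        simpa [p_A6] using hcrit
      · exact Or.inr (Or.inl ⟨h1, hcrit⟩)
    · exact Or.inr (Or.inr (Or.inl hcrit))
  | A7 β₁ =>
    by_cases h : 12 * β₁ + 1 = 0
    · refine Or.inr (Or.inl ?_)
      change β₁ = _
      field_simp
      linear_combination h
    · exact Or.inr (Or.inr (Or.inl h))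
  | A8 α₁ =>
    by_cases h : α₁ = 1 / 3
    · exact Or.inr (Or.inr (Or.inr h))
    · exact Or.inr (Or.inl h)
  | A9 => exact Or.inl trivial
  | A10 => exact Or.inr (Or.inl trivial)
  | A11 => exact Or.inr (Or.inr (Or.inl trivial))
  | A12 => exact Or.inl trivial

/-- Each matrix contains an entry `±1`, or two entries that cannot vanish together: `α₂` and `α₂ +
1`, or `α₁` and `1 - α₁`. -/
theorem nontrivialMul_alg (c : CanonicalForm F) : NontrivialMul c.Alg := by
  by_contra hc
  simp only [NontrivialMul, not_exists, ne_eq, not_not] at hc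
  have h0 : ∀ (u v : c.Alg) (i : Fin 2), c.msc i 0 * (u 0 * v 0) + c.msc i 1 * (u 0 * v 1)
      + c.msc i 2 * (u 1 * v 0) + c.msc i 3 * (u 1 * v 1) = 0 :=
    fun u v i => congrFun (hc u v) i
  have h : ∀ i j, c.msc i j = 0 := by
    intro i j
    fin_cases j
    · simpa using h0 (MSCAlgebra.mk 1 0) (MSCAlgebra.mk 1 0) i
    · simpa using h0 (MSCAlgebra.mk 1 0) (MSCAlgebra.mk 0 1) i
    · simpa using h0 (MSCAlgebra.mk 0 1) (MSCAlgebra.mk 1 0) i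
    · simpa using h0 (MSCAlgebra.mk 0 1) (MSCAlgebra.mk 0 1) i
  have h00 := h 0 0
  have h01 := h 0 1
  have h02 := h 0 2
  have h03 := h 0 3
  have h10 := h 1 0
  have h12 := h 1 2
  have h11 := h 1 1
  cases c <;> simp [msc] at h00 h01 h02 h03 h10 h11 h12 <;> simp_all

end CanonicalForm

end Lists

/-! ### Reduction of every nontrivial algebra to a canonical form -/

section Existence

variable {F : Type u} [Field F]

theorem MSC.eq_of {F : Type u} {N : MSC F} {a b c d a' b' c' d' : F} (h00 : N 0 0 = a) (h01 : N 0 1 = b)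
    (h02 : N 0 2 = c) (h03 : N 0 3 = d) (h10 : N 1 0 = a') (h11 : N 1 1 = b') (h12 : N 1 2 = c')
    (h13 : N 1 3 = d') : N = !![a, b, c, d; a', b', c', d'] := by
  ext i j
  fin_cases i <;> fin_cases j
  · exact h00
  · exact h01
  · exact h02
  · exact h03
  · exact h10
  · exact h11
  · exact h12
  · exact h13

theorem IsChange.of {n₁ n₂ n₃ n₄ n₁' n₂' n₃' n₄' m₁ m₂ m₃ m₄ m₁' m₂' m₃' m₄' a b c d : F}
    (det : a * d - b * c ≠ 0)
    (uu0 : m₁ * (a * a) + m₂ * (a * c) + m₃ * (c * a) + m₄ * (c * c) = n₁ * a + n₁' * b)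
    (uu1 : m₁' * (a * a) + m₂' * (a * c) + m₃' * (c * a) + m₄' * (c * c) = n₁ * c + n₁' * d)
    (uv0 : m₁ * (a * b) + m₂ * (a * d) + m₃ * (c * b) + m₄ * (c * d) = n₂ * a + n₂' * b)
    (uv1 : m₁' * (a * b) + m₂' * (a * d) + m₃' * (c * b) + m₄' * (c * d) = n₂ * c + n₂' * d)
    (vu0 : m₁ * (b * a) + m₂ * (b * c) + m₃ * (d * a) + m₄ * (d * c) = n₃ * a + n₃' * b)
    (vu1 : m₁' * (b * a) + m₂' * (b * c) + m₃' * (d * a) + m₄' * (d * c) = n₃ * c + n₃' * d)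
    (vv0 : m₁ * (b * b) + m₂ * (b * d) + m₃ * (d * b) + m₄ * (d * d) = n₄ * a + n₄' * b)
    (vv1 : m₁' * (b * b) + m₂' * (b * d) + m₃' * (d * b) + m₄' * (d * d) = n₄ * c + n₄' * d) :
    IsChange !![n₁, n₂, n₃, n₄; n₁', n₂', n₃', n₄'] !![m₁, m₂, m₃, m₄; m₁', m₂', m₃', m₄']
      a b c d :=
  ⟨det, uu0, uu1, uv0, uv1, vu0, vu1, vv0, vv1⟩

/-- The algebra `MSCAlgebra M` is isomorphic to a canonical one. -/
def HasCanonicalForm (M : MSC F) : Prop := ∃ c : CanonicalForm F, Iso F (MSCAlgebra M) c.Alg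

theorem CanonicalForm.hasCanonicalForm (c : CanonicalForm F) : HasCanonicalForm c.msc :=
  ⟨c, Iso.refl _⟩

theorem IsChange.hasCanonicalForm {N M : MSC F} {a b c d : F} (h : IsChange N M a b c d)
    (hN : HasCanonicalForm N) : HasCanonicalForm M := by
  obtain ⟨c, hc⟩ := hN
  exact ⟨c, h.iso.symm.trans hc⟩

open CanonicalForm in
theorem hasCanonicalForm_of_traces_independent {M : MSC F}
    (h : (M 0 0 + M 1 1) * (M 0 1 + M 1 3) - (M 0 2 + M 1 3) * (M 0 0 + M 1 2) ≠ 0) :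
    HasCanonicalForm M := by
  generalize hD : (M 0 0 + M 1 1) * (M 0 1 + M 1 3) - (M 0 2 + M 1 3) * (M 0 0 + M 1 2) = D at h
  -- The dual basis: the left trace takes the values 0, 1 and the right trace the values 1, 0 on the
  -- new basis vectors.
  obtain ⟨N, hN⟩ := exists_isChange M (a := -(M 0 2 + M 1 3) / D) (b := (M 0 1 + M 1 3) / D)
    (c := (M 0 0 + M 1 1) / D) (d := -(M 0 0 + M 1 2) / D) (by
      rw [show -(M 0 2 + M 1 3) / D * (-(M 0 0 + M 1 2) / D)
          - (M 0 1 + M 1 3) / D * ((M 0 0 + M 1 1) / D) =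
        -((M 0 0 + M 1 1) * (M 0 1 + M 1 3) - (M 0 2 + M 1 3) * (M 0 0 + M 1 2)) / D ^ 2 by ring,
        hD]
      exact div_ne_zero (neg_ne_zero.2 h) (pow_ne_zero _ h))
  have h1 : N 0 0 + N 1 1 = 0 := by rw [hN.left_trace_fst]; ring
  have h2 : N 0 2 + N 1 3 = 1 := by
    rw [hN.left_trace_snd]; field_simp; linear_combination hD
  have h3 : N 0 0 + N 1 2 = 1 := by
    rw [hN.right_trace_fst]; field_simp; linear_combination hD
  have h4 : N 0 1 + N 1 3 = 0 := by rw [hN.right_trace_snd]; ring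
  refine hN.hasCanonicalForm ?_
  have : N = (A1 (N 0 0) (N 0 1) (N 0 3) (N 1 0)).msc :=
    MSC.eq_of rfl rfl (by linear_combination h2 - h4) rfl rfl (by linear_combination h1)
      (by linear_combination h3) (by linear_combination h4)
  rw [this]
  exact CanonicalForm.hasCanonicalForm _

/-- The structure constants of an algebra whose left and right traces vanish on `e₂`. -/
def adapted (l m α₁ α₂ α₄ β₁ : F) : MSC F :=
  !![α₁, α₂, α₂, α₄; β₁, l - α₁, m - α₁, -α₂]

theorem IsChange.exists_adapted {N M : MSC F} {a b c d : F} (h : IsChange N M a b c d)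
    (hl : (M 0 0 + M 1 1) * b + (M 0 2 + M 1 3) * d = 0)
    (hr : (M 0 0 + M 1 2) * b + (M 0 1 + M 1 3) * d = 0) :
    N = adapted ((M 0 0 + M 1 1) * a + (M 0 2 + M 1 3) * c)
      ((M 0 0 + M 1 2) * a + (M 0 1 + M 1 3) * c) (N 0 0) (N 0 1) (N 0 3) (N 1 0) :=
  MSC.eq_of rfl rfl (by linear_combination h.left_trace_snd + hl - h.right_trace_snd - hr) rfl rfl
    (by linear_combination h.left_trace_fst) (by linear_combination h.right_trace_fst)
    (by linear_combination h.right_trace_snd + hr)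

/-- Scale `e₂` to `v` so that the `e₁`-coefficient of `v * v` is 1, then take `u = v * v` as the
first basis vector. This keeps the traces and makes the last column `(1, 0)`. -/
theorem adapted_of_ne (hsq : ∀ x : F, ∃ s : F, s ^ 2 = x) {l m α₁ α₂ α₄ β₁ : F} (h4 : α₄ ≠ 0)
    (H : ∀ α β, HasCanonicalForm (adapted l m α 0 1 β)) :
    HasCanonicalForm (adapted l m α₁ α₂ α₄ β₁) := by
  obtain ⟨d, hd⟩ := hsq (1 / α₄)
  rw [eq_div_iff h4] at hd
  have hd0 : d ≠ 0 := by
    rintro rfl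
    simp at hd
  obtain ⟨N, hN⟩ := exists_isChange (adapted l m α₁ α₂ α₄ β₁) (a := 1) (b := 0)
    (c := -α₂ * d ^ 2) (d := d) (by simpa using hd0)
  have e := hN.exists_adapted (by simp [adapted]) (by simp [adapted])
  have h0 := hN.vv0
  have h1 := hN.vv1
  simp [adapted] at h0 h1
  have h03 : N 0 3 = 1 := by linear_combination hd - h0
  have h13 : N 1 3 = 0 := by
    rw [h03] at h1
    apply mul_right_cancel₀ hd0
    linear_combination -h1
  have h01 : N 0 1 = 0 := by
    have := congrFun (congrFun e 1) 3
    simp [adapted] at this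
    linear_combination this - h13
  refine hN.hasCanonicalForm ?_
  rw [e, h03, h01]
  convert H (N 0 0) (N 1 0) using 2 <;> simp [adapted]

/-- Scaling `e₂` by `1 / α₂` gives `v * v = -v`. The shear of `e₁` is chosen to cancel the
coefficient `α₁ + 2 α₂ c` of `u` in `u * u`. -/
theorem adapted_of_eq_of_ne (h2 : (2 : F) ≠ 0) {l m α₁ α₂ β₁ : F} (hα : α₂ ≠ 0)
    (H : ∀ β, HasCanonicalForm (adapted l m 0 1 0 β)) :
    HasCanonicalForm (adapted l m α₁ α₂ 0 β₁) := by
  have hd0 : 1 / α₂ ≠ 0 := one_div_ne_zero hα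
  obtain ⟨N, hN⟩ := exists_isChange (adapted l m α₁ α₂ 0 β₁) (a := 1) (b := 0)
    (c := -α₁ / (2 * α₂)) (d := 1 / α₂) (by simpa using hα)
  have e := hN.exists_adapted (by simp [adapted]) (by simp [adapted])
  have h0 := hN.vv0
  have h1 := hN.vv1
  have h2' := hN.uu0
  simp [adapted] at h0 h1 h2'
  have h03 : N 0 3 = 0 := h0.symm
  have h13 : N 1 3 = -1 := by
    rw [h03] at h1
    field_simp at h1
    apply mul_left_cancel₀ h2
    linear_combination -h1
  have h01 : N 0 1 = 1 := by
    have := congrFun (congrFun e 1) 3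
    simp [adapted] at this
    linear_combination this - h13
  have h00 : N 0 0 = 0 := by
    rw [← h2']
    field_simp
    ring
  refine hN.hasCanonicalForm ?_
  rw [e, h03, h01, h00]
  convert H (N 1 0) using 2 <;> simp [adapted]

/-- With `α₂ = α₄ = 0` only `β` changes under `e₁ ↦ e₁ + t e₂`, `e₂ ↦ d e₂`. So `β` can be removed
when `l + m ≠ 3α`, and otherwise can only be rescaled, to 1 if it is nonzero. -/
theorem adapted_shear {l m α β β' t d : F} (hd : d ≠ 0) (h : β' * d = β + (l + m - 3 * α) * t)
    (H : HasCanonicalForm (adapted l m α 0 0 β')) : HasCanonicalForm (adapted l m α 0 0 β) := by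
  have : IsChange (adapted l m α 0 0 β') (adapted l m α 0 0 β) 1 0 t d :=
    IsChange.of (by simpa using hd) (by ring) (by linear_combination -h) (by ring) (by ring)
      (by ring) (by ring) (by ring) (by ring)
  exact this.hasCanonicalForm H

open CanonicalForm

theorem adapted_right (hsq : ∀ x : F, ∃ s : F, s ^ 2 = x) (h2 : (2 : F) ≠ 0)
    (l α₁ α₂ α₄ β₁ : F) : HasCanonicalForm (adapted l 1 α₁ α₂ α₄ β₁) := by
  by_cases h4 : α₄ = 0
  · subst h4
    by_cases hα : α₂ = 0
    · subst hα
      by_cases hl : l + 1 - 3 * α₁ = 0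
      · by_cases hβ : β₁ = 0
        · subst hβ
          convert (A4 α₁ (l - α₁)).hasCanonicalForm using 1
          simp [adapted, msc]
        · refine adapted_shear (β' := 1) (t := 0) hβ (by ring) ?_
          convert (A5 α₁).hasCanonicalForm using 1
          have : l - α₁ = 2 * α₁ - 1 := by linear_combination hl
          simp [adapted, msc, this]
      · refine adapted_shear (β' := 0) (d := 1) (t := -β₁ / (l + 1 - 3 * α₁)) one_ne_zero
          (by rw [mul_div_cancel₀ _ hl]; ring) ?_
        convert (A4 α₁ (l - α₁)).hasCanonicalForm using 1
        simp [adapted, msc]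
    · refine adapted_of_eq_of_ne h2 hα fun β => ?_
      convert (A3 β l).hasCanonicalForm using 1
      simp [adapted, msc]
  · refine adapted_of_ne hsq h4 fun α β => ?_
    convert (A2 α β (l - α)).hasCanonicalForm using 1
    simp [adapted, msc]

theorem adapted_left (hsq : ∀ x : F, ∃ s : F, s ^ 2 = x) (h2 : (2 : F) ≠ 0) (h3 : (3 : F) ≠ 0)
    (α₁ α₂ α₄ β₁ : F) : HasCanonicalForm (adapted 1 0 α₁ α₂ α₄ β₁) := by
  by_cases h4 : α₄ = 0
  · subst h4
    by_cases hα : α₂ = 0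
    · subst hα
      by_cases hl : 1 + 0 - 3 * α₁ = 0
      · by_cases hβ : β₁ = 0
        · subst hβ
          convert (A8 α₁).hasCanonicalForm using 1
          simp [adapted, msc]
        · refine adapted_shear (β' := 1) (t := 0) hβ (by ring) ?_
          have h1 : α₁ = 1 / 3 := by
            rw [eq_div_iff h3]
            linear_combination -hl
          have h23 : 1 - α₁ = 2 / 3 := by rw [h1]; field_simp; ring
          convert (A9 : CanonicalForm F).hasCanonicalForm using 1
          simp only [adapted, msc, h23]
          rw [h1]
          simp
      · refine adapted_shear (β' := 0) (d := 1) (t := -β₁ / (1 + 0 - 3 * α₁)) one_ne_zero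
          (by rw [mul_div_cancel₀ _ hl]; ring) ?_
        convert (A8 α₁).hasCanonicalForm using 1
        simp [adapted, msc]
    · refine adapted_of_eq_of_ne h2 hα fun β => ?_
      convert (A7 β).hasCanonicalForm using 1
      simp [adapted, msc]
  · refine adapted_of_ne hsq h4 fun α β => ?_
    convert (A6 α β).hasCanonicalForm using 1
    simp [adapted, msc]

theorem adapted_traceless_of_eq (hsq : ∀ x : F, ∃ s : F, s ^ 2 = x) (h2 : (2 : F) ≠ 0)
    (h3 : (3 : F) ≠ 0) {α₁ α₂ β₁ : F} (h : ¬(α₁ = 0 ∧ α₂ = 0 ∧ β₁ = 0)) :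
    HasCanonicalForm (adapted 0 0 α₁ α₂ 0 β₁) := by
  by_cases hα : α₂ = 0
  · subst hα
    by_cases h1 : α₁ = 0
    · subst h1
      have hβ : β₁ ≠ 0 := fun hβ => h ⟨rfl, rfl, hβ⟩
      refine adapted_shear (β' := 1) (t := 0) hβ (by ring) ?_
      convert (A12 : CanonicalForm F).hasCanonicalForm using 1
      simp [adapted, msc]
    · refine adapted_shear (β' := 0) (d := 1) (t := β₁ / (3 * α₁)) one_ne_zero
        (by field_simp; ring) ?_
      -- Here `e₁ * e₁ = α₁ e₁`, `e₁ * e₂ = e₂ * e₁ = -α₁ e₂` and `e₂ * e₂ = 0`. This is `A10` with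
      -- the basis vectors exchanged and `e₁` scaled by `-1 / α₁`.
      have : IsChange (A10 : CanonicalForm F).msc (adapted 0 0 α₁ 0 0 0) 0 (-1 / α₁) 1 0 := by
        refine IsChange.of ?_ ?_ ?_ ?_ ?_ ?_ ?_ ?_ ?_
        · simpa using h1
        all_goals field_simp
        all_goals ring
      exact this.hasCanonicalForm (CanonicalForm.hasCanonicalForm _)
  · refine adapted_of_eq_of_ne h2 hα fun β => ?_
    by_cases hβ : β = 0
    · subst hβ
      convert (A10 : CanonicalForm F).hasCanonicalForm using 1
      simp [adapted, msc]
    · obtain ⟨k, hk⟩ := hsq (1 / β)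
      rw [eq_div_iff hβ] at hk
      have hk0 : k ≠ 0 := by
        rintro rfl
        simp at hk
      have : IsChange (A11 : CanonicalForm F).msc (adapted 0 0 0 1 0 β) k 0 0 1 :=
        IsChange.of (by simpa using hk0) (by ring) (by linear_combination hk) (by ring) (by ring)
          (by ring) (by ring) (by ring) (by ring)
      exact this.hasCanonicalForm (CanonicalForm.hasCanonicalForm _)

theorem exists_dual_basis {p q : F} (h : ¬(p = 0 ∧ q = 0)) :
    ∃ a b c d, a * d - b * c ≠ 0 ∧ p * a + q * c = 1 ∧ p * b + q * d = 0 := by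
  by_cases hp : p = 0
  · have hq : q ≠ 0 := fun hq => h ⟨hp, hq⟩
    exact ⟨0, 1, 1 / q, 0, by simpa using hq, by field_simp; ring, by rw [hp]; ring⟩
  · exact ⟨1 / p, -q, 0, p, by simp [hp], by field_simp; ring, by ring⟩

theorem not_nontrivialMul_adapted_zero :
    ¬NontrivialMul (MSCAlgebra (adapted (0 : F) 0 0 0 0 0)) := by
  rintro ⟨x, y, h⟩
  apply h
  funext i
  rw [MSCAlgebra.mul_apply]
  fin_cases i <;> simp [adapted, MSCAlgebra.zero_apply]

theorem hasCanonicalForm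
    (hroot : ∀ q : Polynomial F, q.natDegree = 2 ∨ q.natDegree = 3 → ∃ x : F, q.IsRoot x)
    (h2 : (2 : F) ≠ 0) (h3 : (3 : F) ≠ 0) {M : MSC F} (hM : NontrivialMul (MSCAlgebra M)) :
    HasCanonicalForm M := by
  have hsq := exists_sq_eq hroot
  by_cases hD : (M 0 0 + M 1 1) * (M 0 1 + M 1 3) - (M 0 2 + M 1 3) * (M 0 0 + M 1 2) = 0
  swap
  · exact hasCanonicalForm_of_traces_independent hD
  by_cases hr : M 0 0 + M 1 2 = 0 ∧ M 0 1 + M 1 3 = 0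
  · obtain ⟨hr1, hr2⟩ := hr
    by_cases hl : M 0 0 + M 1 1 = 0 ∧ M 0 2 + M 1 3 = 0
    · obtain ⟨hl1, hl2⟩ := hl
      obtain ⟨a, b, c, d, hdet, N, hN, h03⟩ :
          ∃ a b c d, a * d - b * c ≠ 0 ∧ ∃ N, IsChange N M a b c d ∧ N 0 3 = 0 := by
        by_cases h03 : M 0 3 = 0
        · obtain ⟨N, hN⟩ := exists_isChange M (a := 1) (b := 0) (c := 0) (d := 1) (by simp)
          have h := hN.vv0
          simp only [h03] at h
          exact ⟨_, _, _, _, hN.det, N, hN, by linear_combination -h⟩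
        -- A root `y` of `p` gives a subalgebra spanned by `(1, y)`. Taking this vector as second
        -- basis vector achieves `α₄ = 0`, and zero traces remain zero in any basis.
        · obtain ⟨y, hy⟩ := exists_root_cubic hroot h03 (M 0 1 + M 0 2 - M 1 3)
            (M 0 0 - M 1 1 - M 1 2) (-M 1 0)
          obtain ⟨N, hN⟩ := exists_isChange M (a := 0) (b := 1) (c := 1) (d := y) (by simp)
          exact ⟨_, _, _, _, hN.det, N, hN, by linear_combination y * hN.vv0 - hN.vv1 - hy⟩
      have e := hN.exists_adapted (by simp [hl1, hl2]) (by simp [hr1, hr2])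
      rw [hl1, hl2, hr1, hr2, h03] at e
      simp only [zero_mul, add_zero] at e
      refine hN.hasCanonicalForm ?_
      have hN' := hN.iso.symm.nontrivialMul hM
      rw [e] at hN' ⊢
      refine adapted_traceless_of_eq hsq h2 h3 fun ⟨h00, h01, h10⟩ => ?_
      rw [h00, h01, h10] at hN'
      exact not_nontrivialMul_adapted_zero hN'
    · obtain ⟨a, b, c, d, hdet, hla, hlb⟩ : ∃ a b c d, a * d - b * c ≠ 0 ∧
          (M 0 0 + M 1 1) * a + (M 0 2 + M 1 3) * c = 1 ∧
          (M 0 0 + M 1 1) * b + (M 0 2 + M 1 3) * d = 0 := exists_dual_basis hl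
      obtain ⟨N, hN⟩ := exists_isChange M hdet
      have e := hN.exists_adapted hlb (by simp [hr1, hr2])
      rw [hla, hr1, hr2] at e
      simp only [zero_mul, add_zero] at e
      refine hN.hasCanonicalForm ?_
      rw [e]
      exact adapted_left hsq h2 h3 _ _ _ _
  · obtain ⟨a, b, c, d, hdet, hra, hrb⟩ : ∃ a b c d, a * d - b * c ≠ 0 ∧
        (M 0 0 + M 1 2) * a + (M 0 1 + M 1 3) * c = 1 ∧
        (M 0 0 + M 1 2) * b + (M 0 1 + M 1 3) * d = 0 := exists_dual_basis hr
    obtain ⟨N, hN⟩ := exists_isChange M hdet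
    -- The traces are dependent, so `l(v) r(u) - l(u) r(v) = 0`. With `r(u) = 1` and `r(v) = 0` the
    -- left trace vanishes on `v` as well.
    have e := hN.exists_adapted (by
      linear_combination ((M 0 0 + M 1 1) * b + (M 0 2 + M 1 3) * d) * (-hra)
        + ((M 0 0 + M 1 1) * a + (M 0 2 + M 1 3) * c) * hrb + (b * c - a * d) * hD) hrb
    rw [hra] at e
    refine hN.hasCanonicalForm ?_
    rw [e]
    exact adapted_right hsq h2 _ _ _ _ _

end Existence

/-! ### Canonical forms are isomorphic only when identified -/

section Uniqueness

variable {F : Type u} [Field F]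

namespace CanonicalForm

theorem iso_flip (c : CanonicalForm F) : Iso F c.Alg c.flip.Alg := by
  have h : (1 : F) * -1 - 0 * 0 ≠ 0 := by simp
  cases c with
  | A2 α₁ β₁ β₂ =>
    exact (IsChange.of (a := 1) (b := 0) (c := 0) (d := -1) h (by ring) (by ring) (by ring)
      (by ring) (by ring) (by ring) (by ring) (by ring)).iso
  | A6 α₁ β₁ =>
    exact (IsChange.of (a := 1) (b := 0) (c := 0) (d := -1) h (by ring) (by ring) (by ring)
      (by ring) (by ring) (by ring) (by ring) (by ring)).iso
  | _ => exact Iso.refl _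

theorem Same.iso {c c' : CanonicalForm F} (h : c.Same c') : Iso F c.Alg c'.Alg := by
  rcases h with rfl | rfl
  · exact Iso.refl _
  · exact c.iso_flip

/-- The position of the traces of left and right multiplications: independent, right trace nonzero,
only left trace nonzero, both zero. -/
def kind {F : Type u} : CanonicalForm F → ℕ
  | A1 _ _ _ _ => 0
  | A2 _ _ _ => 1
  | A3 _ _ => 1
  | A4 _ _ => 1
  | A5 _ => 1
  | A6 _ _ => 2
  | A7 _ => 2
  | A8 _ => 2
  | A9 => 2
  | A10 => 3
  | A11 => 3
  | A12 => 3

theorem kind_cases {F : Type u} (c : CanonicalForm F) : c.kind = 0 ∨ c.kind = 1 ∨ c.kind = 2 ∨ c.kind = 3 := by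
  cases c <;> simp [kind]

theorem traces_of_kind_eq_zero {c : CanonicalForm F} (h : c.kind = 0) :
    c.msc 0 0 + c.msc 1 1 = 0 ∧ c.msc 0 2 + c.msc 1 3 = 1 ∧
      c.msc 0 0 + c.msc 1 2 = 1 ∧ c.msc 0 1 + c.msc 1 3 = 0 := by
  cases c <;> simp [kind] at h
  simp [msc]

theorem traces_of_kind_ne_zero {c : CanonicalForm F} (h : c.kind ≠ 0) :
    c.msc 0 2 + c.msc 1 3 = 0 ∧ c.msc 0 1 + c.msc 1 3 = 0 := by
  cases c <;> simp [kind] at h <;> simp [msc]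

theorem right_trace_of_kind_eq_one {c : CanonicalForm F} (h : c.kind = 1) :
    c.msc 0 0 + c.msc 1 2 = 1 := by
  cases c <;> simp [kind] at h <;> simp [msc]

theorem traces_of_kind_eq_two (h3 : (3 : F) ≠ 0) {c : CanonicalForm F} (h : c.kind = 2) :
    c.msc 0 0 + c.msc 1 1 = 1 ∧ c.msc 0 0 + c.msc 1 2 = 0 := by
  cases c <;> simp [kind] at h <;> simp [msc]
  field_simp
  ring

theorem traces_of_kind_eq_three {c : CanonicalForm F} (h : c.kind = 3) :
    c.msc 0 0 + c.msc 1 1 = 0 ∧ c.msc 0 0 + c.msc 1 2 = 0 := by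
  cases c <;> simp [kind] at h <;> simp [msc]

/-- The kind records which linear relations hold between the two traces, and an isomorphism carries
these over. One inequality suffices, since isomorphisms can be reversed. -/
theorem kind_le_of_iso (h3 : (3 : F) ≠ 0) {c c' : CanonicalForm F} (h : Iso F c.Alg c'.Alg) :
    c'.kind ≤ c.kind := by
  obtain ⟨p, q, r, s, h⟩ := h.exists_isChange
  have t1 := h.left_trace_fst
  have t2 := h.left_trace_snd
  have t3 := h.right_trace_fst
  have t4 := h.right_trace_snd
  rcases c'.kind_cases with e' | e' | e' | e'
  · omega
  · have hn := traces_of_kind_ne_zero (c := c') (by omega)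
    rw [hn.1] at t1 t2
    rw [hn.2] at t3 t4
    rcases c.kind_cases with e | e | e | e
    · obtain ⟨a1, a2, a3, a4⟩ := traces_of_kind_eq_zero e
      rw [right_trace_of_kind_eq_one e', a4] at t4
      rw [a2] at t2
      have hq : q = 0 := by linear_combination -t4
      rw [hq] at t2
      simp at t2
    all_goals omega
  · have hn := traces_of_kind_ne_zero (c := c') (by omega)
    rw [hn.2, (traces_of_kind_eq_two h3 e').2] at t3
    rcases c.kind_cases with e | e | e | e
    · rw [(traces_of_kind_eq_zero e).2.2.1] at t3
      simp at t3
    · rw [right_trace_of_kind_eq_one e] at t3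
      simp at t3
    all_goals omega
  · have hn := traces_of_kind_ne_zero (c := c') (by omega)
    rw [hn.1, (traces_of_kind_eq_three e').1] at t1
    rw [hn.2, (traces_of_kind_eq_three e').2] at t3
    rcases c.kind_cases with e | e | e | e
    · rw [(traces_of_kind_eq_zero e).2.2.1] at t3
      simp at t3
    · rw [right_trace_of_kind_eq_one e] at t3
      simp at t3
    · rw [(traces_of_kind_eq_two h3 e).1] at t1
      simp at t1
    · omega

theorem kind_eq_of_iso (h3 : (3 : F) ≠ 0) {c c' : CanonicalForm F} (h : Iso F c.Alg c'.Alg) :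
    c.kind = c'.kind :=
  le_antisymm (kind_le_of_iso h3 h.symm) (kind_le_of_iso h3 h)

/-- Both bases are dual to the traces, so the isomorphism is the identity matrix and the parameters
agree. -/
theorem same_of_iso_of_kind_eq_zero {c c' : CanonicalForm F} (h : Iso F c.Alg c'.Alg)
    (hc : c.kind = 0) (hc' : c'.kind = 0) : c.Same c' := by
  obtain ⟨p, q, r, s, h⟩ := h.exists_isChange
  have t1 := h.left_trace_fst
  have t2 := h.left_trace_snd
  have t3 := h.right_trace_fst
  have t4 := h.right_trace_snd
  obtain ⟨a1, a2, a3, a4⟩ := traces_of_kind_eq_zero hc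
  obtain ⟨b1, b2, b3, b4⟩ := traces_of_kind_eq_zero hc'
  rw [a1, b1, b2, zero_mul, zero_add, one_mul] at t1
  rw [a2, b1, b2, zero_mul, zero_add, one_mul] at t2
  rw [a3, b3, b4, zero_mul, add_zero, one_mul] at t3
  rw [a4, b3, b4, zero_mul, add_zero, one_mul] at t4
  subst t1 t2 t3 t4
  obtain ⟨-, e1, e2, e3, -, -, -, e4, -⟩ := h
  cases c <;> simp [kind] at hc
  cases c' <;> simp [kind] at hc'
  simp [msc] at e1 e2 e3 e4
  exact Or.inl (by rw [e1, e2, e3, e4])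

/-- For `A2` the product `v * v` forces `s ^ 2 = 1` and `r = 0`, and `s = -1` is the sign change of
`β₁`. For `A3` it forces `s = 1`, and `u * u` gives `2r = 0`. For `A4` and `A5` the shear formula
shows that `β₁ = 0` is preserved when `l + 1 = 3α₁`. -/
theorem same_of_isChange_of_kind_eq_one {c c' : CanonicalForm F} {r s : F} (h2 : (2 : F) ≠ 0)
    (h : IsChange c.msc c'.msc 1 0 r s) (hc : c.kind = 1) (hc' : c'.kind = 1) : c.Same c' := by
  obtain ⟨e0, e1, e2, e3, e4, e5, e6, e7, e8⟩ := h
  cases c <;> simp [kind] at hc <;> cases c' <;> simp [kind] at hc' <;>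
    simp [msc] at e0 e1 e2 e3 e4 e5 e6 e7 e8 <;> simp only [Same, flip, A2.injEq, A3.injEq, A4.injEq,
      A5.injEq, reduceCtorEq, or_self] <;> grind

theorem same_of_isChange_of_kind_eq_two {c c' : CanonicalForm F} {r s : F} (h2 : (2 : F) ≠ 0)
    (h : IsChange c.msc c'.msc 1 0 r s) (hc : c.kind = 2) (hc' : c'.kind = 2) : c.Same c' := by
  obtain ⟨e0, e1, e2, e3, e4, e5, e6, e7, e8⟩ := h
  cases c <;> simp [kind] at hc <;> cases c' <;> simp [kind] at hc' <;>
    simp [msc] at e0 e1 e2 e3 e4 e5 e6 e7 e8 <;> simp only [Same, flip, A6.injEq, A7.injEq, A8.injEq,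
      reduceCtorEq, or_self] <;> grind

/-- The traces fix no basis here, but the numbers of subalgebras 2, 3, 1 distinguish the three
algebras. -/
theorem same_of_iso_of_kind_eq_three
    (hroot : ∀ q : Polynomial F, q.natDegree = 2 ∨ q.natDegree = 3 → ∃ x : F, q.IsRoot x)
    (h2 : (2 : F) ≠ 0) (h3 : (3 : F) ≠ 0) {c c' : CanonicalForm F} (h : Iso F c.Alg c'.Alg)
    (hc : c.kind = 3) (hc' : c'.kind = 3) : c.Same c' := by
  have h10 : numSubalgebras F (A10 : CanonicalForm F).Alg = 2 :=
    numSubalgebras_of_twoList hroot h2 h3 trivial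
  have h11 : numSubalgebras F (A11 : CanonicalForm F).Alg = 3 :=
    numSubalgebras_of_threeList hroot h2 h3 trivial
  have h12 : numSubalgebras F (A12 : CanonicalForm F).Alg = 1 :=
    numSubalgebras_of_oneList h3 trivial
  have e := h.numSubalgebras_eq
  cases c <;> simp [kind] at hc <;> cases c' <;> simp [kind] at hc' <;>
    first
    | exact Or.inl rfl
    | (simp only [h10, h11, h12] at e; norm_num at e)

theorem iso_iff_same
    (hroot : ∀ q : Polynomial F, q.natDegree = 2 ∨ q.natDegree = 3 → ∃ x : F, q.IsRoot x)
    (h2 : (2 : F) ≠ 0) (h3 : (3 : F) ≠ 0) {c c' : CanonicalForm F} :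
    Iso F c.Alg c'.Alg ↔ c.Same c' := by
  refine ⟨fun h => ?_, Same.iso⟩
  have hk := kind_eq_of_iso h3 h
  rcases c.kind_cases with e | e | e | e
  · exact same_of_iso_of_kind_eq_zero h e (hk ▸ e)
  -- Comparing right traces, which are `(1, 0)` on both sides, forces `u = e₁ + r e₂` and `v = s
  -- e₂`. For kind 2 the left traces play this role.
  · have e' : c'.kind = 1 := hk ▸ e
    obtain ⟨p, q, r, s, h⟩ := h.exists_isChange
    have t3 := h.right_trace_fst
    have t4 := h.right_trace_snd
    rw [right_trace_of_kind_eq_one e, right_trace_of_kind_eq_one e',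
      (traces_of_kind_ne_zero (c := c') (by omega)).2, one_mul, zero_mul, add_zero] at t3
    rw [(traces_of_kind_ne_zero (c := c) (by omega)).2, right_trace_of_kind_eq_one e',
      (traces_of_kind_ne_zero (c := c') (by omega)).2, one_mul, zero_mul, add_zero] at t4
    subst t3 t4
    exact same_of_isChange_of_kind_eq_one h2 h e e'
  · have e' : c'.kind = 2 := hk ▸ e
    obtain ⟨p, q, r, s, h⟩ := h.exists_isChange
    have t1 := h.left_trace_fst
    have t2 := h.left_trace_snd
    rw [(traces_of_kind_eq_two h3 e).1, (traces_of_kind_eq_two h3 e').1,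
      (traces_of_kind_ne_zero (c := c') (by omega)).1, one_mul, zero_mul, add_zero] at t1
    rw [(traces_of_kind_ne_zero (c := c) (by omega)).1, (traces_of_kind_eq_two h3 e').1,
      (traces_of_kind_ne_zero (c := c') (by omega)).1, one_mul, zero_mul, add_zero] at t2
    subst t1 t2
    exact same_of_isChange_of_kind_eq_two h2 h e e'
  · exact same_of_iso_of_kind_eq_three hroot h2 h3 h e (hk ▸ e)

end CanonicalForm

/-- The number of one-dimensional subalgebras decides the list a canonical form is in. -/
theorem CanonicalForm.numSubalgebras_iff
    (hroot : ∀ q : Polynomial F, q.natDegree = 2 ∨ q.natDegree = 3 → ∃ x : F, q.IsRoot x)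
    (h2 : (2 : F) ≠ 0) (h3 : (3 : F) ≠ 0) (c : CanonicalForm F) :
    (numSubalgebras F c.Alg = 1 ↔ c.OneList) ∧ (numSubalgebras F c.Alg = 2 ↔ c.TwoList) ∧
      (numSubalgebras F c.Alg = 3 ↔ c.ThreeList) ∧
      (numSubalgebras F c.Alg = ⊤ ↔ c.InfiniteList) := by
  have := infinite_of_hroot hroot h2
  have i1 : c.OneList → numSubalgebras F c.Alg = 1 := numSubalgebras_of_oneList h3
  have i2 : c.TwoList → numSubalgebras F c.Alg = 2 := numSubalgebras_of_twoList hroot h2 h3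
  have i3 : c.ThreeList → numSubalgebras F c.Alg = 3 := numSubalgebras_of_threeList hroot h2 h3
  have i4 : c.InfiniteList → numSubalgebras F c.Alg = ⊤ := numSubalgebras_of_infiniteList h3
  have h12 : (1 : ℕ∞) ≠ 2 := by norm_num
  have h13 : (1 : ℕ∞) ≠ 3 := by norm_num
  have h23 : (2 : ℕ∞) ≠ 3 := by norm_num
  have h1 : (1 : ℕ∞) ≠ ⊤ := ENat.one_ne_top
  have h2' : (2 : ℕ∞) ≠ ⊤ := ENat.natCast_ne_top 2
  have h3' : (3 : ℕ∞) ≠ ⊤ := ENat.natCast_ne_top 3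
  -- The lists are exhaustive and their counts 1, 2, 3, `⊤` are distinct, so each one-way
  -- implication reverses.
  have hm := mem_lists hroot h2 h3 c
  refine ⟨⟨fun h => ?_, i1⟩, ⟨fun h => ?_, i2⟩, ⟨fun h => ?_, i3⟩, ⟨fun h => ?_, i4⟩⟩ <;>
    grind

/-! ### Transfer to arbitrary two-dimensional algebras -/

theorem isomorphicOnlyToOneOf_iff
    (hroot : ∀ q : Polynomial F, q.natDegree = 2 ∨ q.natDegree = 3 → ∃ x : F, q.IsRoot x)
    (h2 : (2 : F) ≠ 0) (h3 : (3 : F) ≠ 0) {A : Type v} [NonUnitalNonAssocRing A] [Module F A]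
    [IsScalarTower F A A] [SMulCommClass F A A] {L : CanonicalForm F → Prop} {n : ℕ∞}
    (hL : ∀ c : CanonicalForm F, numSubalgebras F c.Alg = n ↔ L c) {c : CanonicalForm F}
    (hc : Iso F A c.Alg) : numSubalgebras F A = n ↔ IsomorphicOnlyToOneOf L A := by
  constructor
  · intro h
    refine ⟨c, (hL c).1 (hc.numSubalgebras_eq ▸ h), fun c' => ?_⟩
    rw [← CanonicalForm.iso_iff_same hroot h2 h3]
    exact ⟨fun h' => hc.symm.trans h', fun h' => hc.trans h'⟩
  · rintro ⟨c', hc', h'⟩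
    rw [((h' c').2 (Or.inl rfl)).numSubalgebras_eq]
    exact (hL c').2 hc'

theorem exists_iso_canonicalForm
    (hroot : ∀ q : Polynomial F, q.natDegree = 2 ∨ q.natDegree = 3 → ∃ x : F, q.IsRoot x)
    (h2 : (2 : F) ≠ 0) (h3 : (3 : F) ≠ 0) (A : Type v) [NonUnitalNonAssocRing A] [Module F A]
    [IsScalarTower F A A] [SMulCommClass F A A] (hA : finrank F A = 2) (hA' : NontrivialMul A) :
    ∃ c : CanonicalForm F, Iso F A c.Alg := by
  obtain ⟨M, hM⟩ := exists_iso_MSCAlgebra (F := F) A hA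
  obtain ⟨c, hc⟩ := hasCanonicalForm hroot h2 h3 (hM.nontrivialMul hA')
  exact ⟨c, hM.trans hc⟩

end Uniqueness

end TwoDim

theorem theorem3p1 {F : Type u} [Field F] (hchar2 : ringChar F ≠ 2) (hchar3 : ringChar F ≠ 3)
    (hroot : ∀ q : Polynomial F, q.natDegree = 2 ∨ q.natDegree = 3 → ∃ x : F, q.IsRoot x) :
    (∀ (A : Type v) [NonUnitalNonAssocRing A] [Module F A] [IsScalarTower F A A]
        [SMulCommClass F A A], Module.finrank F A = 2 → TwoDim.NontrivialMul A →
      (TwoDim.numSubalgebras F A = 1 ∨ TwoDim.numSubalgebras F A = 2 ∨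
        TwoDim.numSubalgebras F A = 3 ∨ TwoDim.numSubalgebras F A = ⊤) ∧
      (TwoDim.numSubalgebras F A = 1 ↔
        TwoDim.IsomorphicOnlyToOneOf (F := F) TwoDim.CanonicalForm.OneList A) ∧
      (TwoDim.numSubalgebras F A = 2 ↔
        TwoDim.IsomorphicOnlyToOneOf (F := F) TwoDim.CanonicalForm.TwoList A) ∧
      (TwoDim.numSubalgebras F A = 3 ↔
        TwoDim.IsomorphicOnlyToOneOf (F := F) TwoDim.CanonicalForm.ThreeList A) ∧
      (TwoDim.numSubalgebras F A = ⊤ ↔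
        TwoDim.IsomorphicOnlyToOneOf (F := F) TwoDim.CanonicalForm.InfiniteList A)) ∧
    (∀ c : TwoDim.CanonicalForm F,
      Module.finrank F c.Alg = 2 ∧ TwoDim.NontrivialMul c.Alg ∧
      (TwoDim.numSubalgebras F c.Alg = 1 ↔ c.OneList) ∧
      (TwoDim.numSubalgebras F c.Alg = 2 ↔ c.TwoList) ∧
      (TwoDim.numSubalgebras F c.Alg = 3 ↔ c.ThreeList) ∧
      (TwoDim.numSubalgebras F c.Alg = ⊤ ↔ c.InfiniteList)) := by
  have h2 : (2 : F) ≠ 0 := Ring.two_ne_zero hchar2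
  have h3 : (3 : F) ≠ 0 := by
    intro h
    have hd : ringChar F ∣ 3 := ringChar.dvd (by exact_mod_cast h)
    rcases (Nat.dvd_prime Nat.prime_three).1 hd with h1 | h1
    · exact CharP.ringChar_ne_one h1
    · exact hchar3 h1
  have key := TwoDim.CanonicalForm.numSubalgebras_iff hroot h2 h3
  refine ⟨fun A _ _ _ _ hA hA' => ?_, fun c =>
    ⟨TwoDim.finrank_MSCAlgebra _, c.nontrivialMul_alg, key c⟩⟩
  obtain ⟨c, hc⟩ := TwoDim.exists_iso_canonicalForm hroot h2 h3 A hA hA'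
  refine ⟨?_, TwoDim.isomorphicOnlyToOneOf_iff hroot h2 h3 (fun c => (key c).1) hc,
    TwoDim.isomorphicOnlyToOneOf_iff hroot h2 h3 (fun c => (key c).2.1) hc,
    TwoDim.isomorphicOnlyToOneOf_iff hroot h2 h3 (fun c => (key c).2.2.1) hc,
    TwoDim.isomorphicOnlyToOneOf_iff hroot h2 h3 (fun c => (key c).2.2.2) hc⟩
  rw [hc.numSubalgebras_eq]
  rcases TwoDim.CanonicalForm.mem_lists hroot h2 h3 c with h | h | h | h
  · exact Or.inl ((key c).1.2 h)
  · exact Or.inr (Or.inl ((key c).2.1.2 h))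
  · exact Or.inr (Or.inr (Or.inl ((key c).2.2.1.2 h)))
  · exact Or.inr (Or.inr (Or.inr ((key c).2.2.2.2 h)))
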